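/- Let $n,a,b,c,p$ be real constants with $n\neq 1$, $b\neq 0$, $a+b\neq 0$, $p\neq 0$, $p\neq -1$, and consider the hyperbolic quasilinear radial wave equation for $u(t,r)$, $r>0$, $$u_{tt}=(c+(a+b)u_r^{p})\,u_{rr}+\frac{n-1}{r}\,(c\,u_r+b\,u_r^{p+1}).$$ A point symmetry is a smooth vector field $\hat X=\tau\partial_t+\xi\partial_r+\eta\partial_u$, with $\tau,\xi,\eta$ functions of $(t,r,u)$, such that $P=\eta-\tau u_t-\xi u_r$ satisfies, on all formal solutions, the linearized equation $D_t^2P-(f_{u_r}+u_{rr}g_{u_r})D_rP-gD_r^2P=0$, where $g=c+(a+b)u_r^p$, $f=\frac{n-1}{r}(cu_r+bu_r^{p+1})$. Here the vector fields are defined on an arbitrary given nonempty connected open set of points $(t,r,u)$ with $r>0$, and $u_r$ ranges over an arbitrary given nonempty open set of real numbers at which $u_r^p$ is defined and smooth ($u_r>0$ in general; also $u_r<0$ if $p$ is an integer, and $u_r=0$ if $p$ is a positive integer). Put $$\hat X_1=\partial_t,\quad \hat X_2=t\partial_t+r\partial_r+u\partial_u,\quad \hat X_3=\partial_u,\quad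 \hat X_4=t\partial_u,$$ $$\hat X_5=pt\,\partial_t-2u\,\partial_u,\quad \hat X_6=t^2\partial_t+tu\,\partial_u,\quad \hat X_7=r^{-m}\partial_r,\quad \hat X_8=r\ln r\,\partial_r,\qquad m=\frac{b(n-1)(p+1)}{a+b}.$$ (General case) If $c\neq 0$, the point symmetries form a 4-dimensional Lie algebra with basis $\hat X_1,\dots,\hat X_4$ (time translation, scaling, two shifts of $u$). For every $c$, $$[\hat X_1,\hat X_2]=\hat X_1,\quad [\hat X_1,\hat X_4]=\hat X_3,\quad [\hat X_2,\hat X_3]=-\hat X_3,\quad [\hat X_1,\hat X_3]=[\hat X_2,\hat X_4]=[\hat X_3,\hat X_4]=0. \tag{1}$$ (Case $c=0$) The point symmetries form a larger Lie algebra, as follows, and in each subcase, besides (1), $$[\hat X_1,\hat X_5]=p\hat X_1,\quad [\hat X_2,\hat X_5]=0,\quad [\hat X_3,\hat X_5]=-2\hat X_3,\quad [\hat X_4,\hat X_5]=-(2+p)\hat X_4 .$$ - If $p\neq -2$ and $p\neq -4$, the algebra is 5-dimensional with basis $\hat X_1,\dots,\hat X_5$. - If $p=-4$, it is 6-dimensional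 with basis $\hat X_1,\dots,\hat X_5,\hat X_6$, and $[\hat X_1,\hat X_6]=-\tfrac12\hat X_5$, $[\hat X_2,\hat X_6]=\hat X_6$, $[\hat X_3,\hat X_6]=\hat X_4$, $[\hat X_4,\hat X_6]=0$, $[\hat X_5,\hat X_6]=-4\hat X_6$. - If $p=-2$ and $a\neq b(n-2)$, it is 6-dimensional with basis $\hat X_1,\dots,\hat X_5,\hat X_7$, and $[\hat X_1,\hat X_7]=[\hat X_3,\hat X_7]=[\hat X_4,\hat X_7]=[\hat X_5,\hat X_7]=0$, $[\hat X_2,\hat X_7]=-(m+1)\hat X_7$. - If $p=-2$ and $a=b(n-2)$, it is 6-dimensional with basis $\hat X_1,\dots,\hat X_5,\hat X_8$, and $[\hat X_1,\hat X_8]=[\hat X_3,\hat X_8]=[\hat X_4,\hat X_8]=[\hat X_5,\hat X_8]=0$, $[\hat X_2,\hat X_8]=\hat X_2+\tfrac12\hat X_5$. -/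

import Mathlib

noncomputable section

namespace RadialWave

/-- A point of the third-order jet space of functions `u(t,r)`:
the independent variables, `u`, and all its partial derivatives up to order three. -/
@[ext]
structure Jet where
  (t r u ut ur utt utr urr uttt uttr utrr urrr : ℝ)

/-- The total derivative with respect to `t` of a function on jet space
that depends on derivatives of `u` of order at most two. -/
def Dt (F : Jet → ℝ) (j : Jet) : ℝ :=
  deriv (fun s => F { j with t := s }) j.t
    + j.ut * deriv (fun s => F { j with u := s }) j.u
    + j.utt * deriv (fun s => F { j with ut := s }) j.ut
    + j.utr * deriv (fun s => F { j with ur := s }) j.ur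
    + j.uttt * deriv (fun s => F { j with utt := s }) j.utt
    + j.uttr * deriv (fun s => F { j with utr := s }) j.utr
    + j.utrr * deriv (fun s => F { j with urr := s }) j.urr

/-- The total derivative with respect to `r` of a function on jet space
that depends on derivatives of `u` of order at most two. -/
def Dr (F : Jet → ℝ) (j : Jet) : ℝ :=
  deriv (fun s => F { j with r := s }) j.r
    + j.ur * deriv (fun s => F { j with u := s }) j.u
    + j.utr * deriv (fun s => F { j with ut := s }) j.ut
    + j.urr * deriv (fun s => F { j with ur := s }) j.ur
    + j.uttr * deriv (fun s => F { j with utt := s }) j.utt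
    + j.utrr * deriv (fun s => F { j with utr := s }) j.utr
    + j.urrr * deriv (fun s => F { j with urr := s }) j.urr

/-- The differential function `u_tt - g(r,u,u_r) u_rr - f(r,u,u_r)`, whose vanishing is the
radial wave equation. -/
def waveOp (g f : ℝ → ℝ → ℝ → ℝ) (j : Jet) : ℝ :=
  j.utt - g j.r j.u j.ur * j.urr - f j.r j.u j.ur

/-- Vector fields on the space of the variables `(t, r, u)`; the value `(τ, ξ, η)` stands for
`τ ∂/∂t + ξ ∂/∂r + η ∂/∂u`. -/
abbrev Field : Type := ℝ × ℝ × ℝ → ℝ × ℝ × ℝ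

/-- The characteristic function `P = η - τ u_t - ξ u_r` of a vector field. -/
def charFn (X : Field) (j : Jet) : ℝ :=
  (X (j.t, j.r, j.u)).2.2 - (X (j.t, j.r, j.u)).1 * j.ut - (X (j.t, j.r, j.u)).2.1 * j.ur

/-- The Fréchet derivative of the wave equation applied to `P`:
`D_t² P - (f_u + u_rr g_u) P - (f_{u_r} + u_rr g_{u_r}) D_r P - g D_r² P`. -/
def linWaveOp (g f : ℝ → ℝ → ℝ → ℝ) (P : Jet → ℝ) (j : Jet) : ℝ :=
  Dt (Dt P) j
    - (deriv (fun s => f j.r s j.ur) j.u + j.urr * deriv (fun s => g j.r s j.ur) j.u) * P j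
    - (deriv (fun s => f j.r j.u s) j.ur + j.urr * deriv (fun s => g j.r j.u s) j.ur) * Dr P j
    - g j.r j.u j.ur * Dr (Dr P) j

/-- `X` is an (infinitesimal) point symmetry over `U` of the radial wave equation
`u_tt = g u_rr + f` considered for `u_r ∈ V`: it is smooth on `U`, and the linearized equation
for its characteristic function holds at every jet over `U`, with `u_r ∈ V`, that satisfies the
wave equation and its first-order differential consequences. -/
def IsPointSymmetry (g f : ℝ → ℝ → ℝ → ℝ) (U : Set (ℝ × ℝ × ℝ)) (V : Set ℝ) (X : Field) : Prop :=
  ContDiffOn ℝ (⊤ : ℕ∞) X U ∧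
    ∀ j : Jet, (j.t, j.r, j.u) ∈ U → j.ur ∈ V →
      waveOp g f j = 0 → Dt (waveOp g f) j = 0 → Dr (waveOp g f) j = 0 →
        linWaveOp g f (charFn X) j = 0

/-- The set of all point symmetries over `U`, as vector fields on `U`. -/
def pointSymmetries (g f : ℝ → ℝ → ℝ → ℝ) (U : Set (ℝ × ℝ × ℝ)) (V : Set ℝ) :
    Set (U → ℝ × ℝ × ℝ) :=
  { Y | ∃ X : Field, IsPointSymmetry g f U V X ∧ Y = U.domRestrict X }

/-- The set `S` of vector fields on `U` is a `d`-dimensional real vector space with basis the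
restrictions to `U` of `X 0, …, X (d-1)`. -/
def HasBasis (U : Set (ℝ × ℝ × ℝ)) (S : Set (U → ℝ × ℝ × ℝ)) {d : ℕ} (X : Fin d → Field) : Prop :=
  LinearIndependent ℝ (fun i => U.domRestrict (X i)) ∧
    S = (Submodule.span ℝ (Set.range fun i => U.domRestrict (X i)) : Set (U → ℝ × ℝ × ℝ))

/-- On `U`, the commutator `[X, Y]` of vector fields equals `Z`. -/
def Comm (U : Set (ℝ × ℝ × ℝ)) (X Y Z : Field) : Prop :=
  Set.EqOn (VectorField.lieBracket ℝ X Y) Z U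

/-- The real numbers `v` at which the power `v ^ p` is defined and depends smoothly on `v`:
all of `ℝ` if `p` is a natural number, `v ≠ 0` if `p` is an integer, `v > 0` for other `p`. -/
def powDomain (p : ℝ) : Set ℝ :=
  { v | 0 < v ∨ (v ≠ 0 ∧ ∃ k : ℤ, p = k) ∨ ∃ k : ℕ, p = k }

/-- The coefficient `c + (a+b) u_r^p` of `u_rr`. -/
def gB (a b c p : ℝ) : ℝ → ℝ → ℝ → ℝ := fun _ _ v => c + (a + b) * v ^ p

/-- The lower-order term `(n-1)(c u_r + b u_r^{p+1})/r`. -/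
def fB (n b c p : ℝ) : ℝ → ℝ → ℝ → ℝ := fun r _ v => (n - 1) * (c * v + b * v ^ (p + 1)) / r

/-- Time translation `∂_t`. -/
def X1 : Field := fun _ => (1, 0, 0)
/-- Scaling `t ∂_t + r ∂_r + u ∂_u`. -/
def X2 : Field := fun x => (x.1, x.2.1, x.2.2)
/-- Shift `∂_u`. -/
def X3 : Field := fun _ => (0, 0, 1)
/-- Shift `t ∂_u`. -/
def X4 : Field := fun x => (0, 0, x.1)
/-- Temporal scaling `p t ∂_t - 2 u ∂_u`. -/
def X5 (p : ℝ) : Field := fun x => (p * x.1, 0, -2 * x.2.2)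
/-- Temporal inversion `t² ∂_t + t u ∂_u`. -/
def X6 : Field := fun x => (x.1 ^ 2, 0, x.1 * x.2.2)
/-- Non-rigid scaling `r^{-m} ∂_r`. -/
def X7 (m : ℝ) : Field := fun x => (0, x.2.1 ^ (-m), 0)
/-- Logarithmic scaling `r ln r ∂_r`. -/
def X8 : Field := fun x => (0, x.2.1 * Real.log x.2.1, 0)

end RadialWave

end

/-!
A vector field `T ∂_t + Ξ ∂_r + H ∂_u` is a point symmetry iff its second prolongation annihilates
the wave equation on solutions. The jets that satisfy the equation and its first differential
consequences are parametrized freely by `t, r, u, u_t, u_r, u_tr, u_rr, u_trr, u_rrr`: the equation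
gives `u_tt`, its derivatives give `u_ttt` and `u_ttr`. On such jets the linearized operator, applied
to the characteristic function, is an expression `prolong` that is polynomial in `u_t, u_tr, u_rr`
and a combination of `1, v, v^p, v^{p+1}` in `v = u_r` (`isPointSymmetry_iff`).

Splitting with respect to these variables uses that `1, v, v^p, v^{p+1}` are independent on any
nonempty open set unless `p = 1`, which is seen by applying the Euler operator `v d/dv`
(`coeffs_of_combination_eq_zero`). The result is the system `IsDetSolution`: `T` depends only on
`t`, `Ξ` only on `r`, and `H` on `t, u` affinely in `u`, with
`p (H_u - Ξ_r) = 2 (Ξ_r - T_t)`, `c (Ξ_r - T_t) = 0`, `2 H_tu = T_tt`, `H_tt = 0` and the Euler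
equation `(a+b) r² Ξ_rr = b (n-1) (r Ξ_r - Ξ)`. For `p = 1`, `c ≠ 0` the equation `H_r = 0` is a
further compatibility condition (`isDetSolution_of_prolong_eq_zero`).

The compatibility conditions `(p+4) T_tt = 0`, `c T_tt = 0`, `(p+2) Ξ_rr = 0`, `c Ξ_rr = 0`
separate the cases. If `Ξ_rr = 0` the Euler equation leaves `Ξ = κ r`. If `p = -2` and `c = 0`,
its solutions are spanned by `r` and `r^{-m}`, or by `r` and `r ln r` when `m = -1`, which is the
condition `a = b (n-2)`. The domain `U` need not have connected slices, so the system is integrated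
by exhibiting functions with vanishing gradient, which are constant since `U` is connected
(`exists_const_of_pd_eq_zero`, `exists_eq_add_const`).
-/

namespace RadialWave

/-! ### Partial derivatives of functions of `(t, r, u)` -/

/-- The derivative of `F` in the constant direction `e`. -/
noncomputable def pd (e : ℝ × ℝ × ℝ) (F : ℝ × ℝ × ℝ → ℝ) : ℝ × ℝ × ℝ → ℝ := fun x => fderiv ℝ F x e

/-- The partial derivative `∂/∂t` of a function of `(t, r, u)`. -/
noncomputable abbrev dT (F : ℝ × ℝ × ℝ → ℝ) : ℝ × ℝ × ℝ → ℝ := pd (1, 0, 0) F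
/-- The partial derivative `∂/∂r` of a function of `(t, r, u)`. -/
noncomputable abbrev dR (F : ℝ × ℝ × ℝ → ℝ) : ℝ × ℝ × ℝ → ℝ := pd (0, 1, 0) F
/-- The partial derivative `∂/∂u` of a function of `(t, r, u)`. -/
noncomputable abbrev dU (F : ℝ × ℝ × ℝ → ℝ) : ℝ × ℝ × ℝ → ℝ := pd (0, 0, 1) F

section Partial

variable {U : Set (ℝ × ℝ × ℝ)} {F G : ℝ × ℝ × ℝ → ℝ} {x : ℝ × ℝ × ℝ}

theorem contDiffOn_pd (hU : IsOpen U) (hF : ContDiffOn ℝ (⊤ : ℕ∞) F U) (e : ℝ × ℝ × ℝ) :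
    ContDiffOn ℝ (⊤ : ℕ∞) (pd e F) U :=
  (hF.fderiv_of_isOpen hU (m := ((⊤ : ℕ∞) : WithTop ℕ∞)) (by simp)).clm_apply contDiffOn_const

theorem differentiableAt_of_contDiffOn (hU : IsOpen U) (hF : ContDiffOn ℝ (⊤ : ℕ∞) F U)
    (hx : x ∈ U) : DifferentiableAt ℝ F x :=
  (hF.contDiffAt (hU.mem_nhds hx)).differentiableAt (by simp)

theorem pd_comm (hU : IsOpen U) (hF : ContDiffOn ℝ (⊤ : ℕ∞) F U) (hx : x ∈ U)
    (e e' : ℝ × ℝ × ℝ) : pd e (pd e' F) x = pd e' (pd e F) x := by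
  have hc : ContDiffAt ℝ (⊤ : ℕ∞) F x := hF.contDiffAt (hU.mem_nhds hx)
  have hd : DifferentiableAt ℝ (fderiv ℝ F) x :=
    (hc.fderiv_right (m := 1) (by norm_cast)).differentiableAt (by simp)
  have key : ∀ e₁ e₂ : ℝ × ℝ × ℝ, pd e₁ (pd e₂ F) x = fderiv ℝ (fderiv ℝ F) x e₁ e₂ := by
    intro e₁ e₂
    have h : HasFDerivAt (pd e₂ F) ((fderiv ℝ (fderiv ℝ F) x).flip e₂) x :=
      HasFDerivAt.congr_fderiv (hd.hasFDerivAt.clm_apply (hasFDerivAt_const e₂ x)) (by ext <;> simp)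
    simp [pd, h.fderiv]
  rw [key, key]
  exact (hc.isSymmSndFDerivAt (by
    simpa using WithTop.coe_le_coe.2 (le_top : (2 : ℕ∞) ≤ ⊤))).eq e e'

theorem pd_congr (hU : IsOpen U) (h : Set.EqOn F G U) (hx : x ∈ U) (e : ℝ × ℝ × ℝ) :
    pd e F x = pd e G x := by
  have : F =ᶠ[nhds x] G := Filter.eventuallyEq_of_mem (hU.mem_nhds hx) h
  simp [pd, this.fderiv_eq]

theorem pd_const (k : ℝ) (e : ℝ × ℝ × ℝ) : pd e (fun _ => k) x = 0 := by simp [pd]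

theorem pd_eq_zero (hU : IsOpen U) (h : ∀ y ∈ U, F y = 0) (hx : x ∈ U) (e : ℝ × ℝ × ℝ) :
    pd e F x = 0 :=
  (pd_congr (G := fun _ => 0) hU h hx e).trans (pd_const 0 e)

theorem hasDerivAt_slice_t (hF : DifferentiableAt ℝ F x) :
    HasDerivAt (fun s => F (s, x.2.1, x.2.2)) (dT F x) x.1 := by
  have h1 : HasDerivAt (fun s : ℝ => (s, x.2.1, x.2.2)) ((1 : ℝ), (0 : ℝ), (0 : ℝ)) x.1 :=
    (hasDerivAt_id _).prodMk ((hasDerivAt_const _ _).prodMk (hasDerivAt_const _ _))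
  exact (hF.hasFDerivAt (x := (x.1, x.2.1, x.2.2))).comp_hasDerivAt _ h1

theorem hasDerivAt_slice_r (hF : DifferentiableAt ℝ F x) :
    HasDerivAt (fun s => F (x.1, s, x.2.2)) (dR F x) x.2.1 := by
  have h1 : HasDerivAt (fun s : ℝ => (x.1, s, x.2.2)) ((0 : ℝ), (1 : ℝ), (0 : ℝ)) x.2.1 :=
    (hasDerivAt_const _ _).prodMk ((hasDerivAt_id _).prodMk (hasDerivAt_const _ _))
  exact (hF.hasFDerivAt (x := (x.1, x.2.1, x.2.2))).comp_hasDerivAt _ h1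

theorem hasDerivAt_slice_u (hF : DifferentiableAt ℝ F x) :
    HasDerivAt (fun s => F (x.1, x.2.1, s)) (dU F x) x.2.2 := by
  have h1 : HasDerivAt (fun s : ℝ => (x.1, x.2.1, s)) ((0 : ℝ), (0 : ℝ), (1 : ℝ)) x.2.2 :=
    (hasDerivAt_const _ _).prodMk ((hasDerivAt_const _ _).prodMk (hasDerivAt_id _))
  exact (hF.hasFDerivAt (x := (x.1, x.2.1, x.2.2))).comp_hasDerivAt _ h1

theorem dT_eq_of_hasDerivAt (hF : DifferentiableAt ℝ F x) {d : ℝ}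
    (h : HasDerivAt (fun s => F (s, x.2.1, x.2.2)) d x.1) : dT F x = d :=
  (hasDerivAt_slice_t hF).unique h

theorem dR_eq_of_hasDerivAt (hF : DifferentiableAt ℝ F x) {d : ℝ}
    (h : HasDerivAt (fun s => F (x.1, s, x.2.2)) d x.2.1) : dR F x = d :=
  (hasDerivAt_slice_r hF).unique h

theorem dU_eq_of_hasDerivAt (hF : DifferentiableAt ℝ F x) {d : ℝ}
    (h : HasDerivAt (fun s => F (x.1, x.2.1, s)) d x.2.2) : dU F x = d :=
  (hasDerivAt_slice_u hF).unique h

/-- On a connected open set, a function with vanishing gradient is constant. -/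
theorem exists_const_of_pd_eq_zero (hU : IsOpen U) (hUc : IsConnected U)
    (hF : DifferentiableOn ℝ F U) (ht : ∀ x ∈ U, dT F x = 0) (hr : ∀ x ∈ U, dR F x = 0)
    (hu : ∀ x ∈ U, dU F x = 0) : ∃ k, ∀ x ∈ U, F x = k := by
  refine hU.exists_is_const_of_fderiv_eq_zero hUc.isPreconnected hF fun x hx => ?_
  ext
  · exact ht x hx
  · exact hr x hx
  · exact hu x hx

end Partial

/-! ### Total derivatives of functions of jets -/

/-- Coefficients of a derivation on functions of the second-order jet variables: one real number
for each of `∂/∂t, ∂/∂r, ∂/∂u, ∂/∂u_t, ∂/∂u_r, ∂/∂u_tt, ∂/∂u_tr, ∂/∂u_rr`. -/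
structure Dir where
  (t r u ut ur utt utr urr : ℝ)

/-- The coefficients of the total derivative `D_t` at a jet. -/
def dirT (j : Jet) : Dir := ⟨1, 0, j.ut, j.utt, j.utr, j.uttt, j.uttr, j.utrr⟩

/-- The coefficients of the total derivative `D_r` at a jet. -/
def dirR (j : Jet) : Dir := ⟨0, 1, j.ur, j.utr, j.urr, j.uttr, j.utrr, j.urrr⟩

/-- `F` has partial derivatives at the jet `j` with respect to all jet variables of order at most
two, and `a` is the combination of these with the coefficients `k`. -/
def HasD (k : Dir) (F : Jet → ℝ) (j : Jet) (a : ℝ) : Prop :=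
  ∃ d : Dir, HasDerivAt (fun s => F { j with t := s }) d.t j.t ∧
    HasDerivAt (fun s => F { j with r := s }) d.r j.r ∧
    HasDerivAt (fun s => F { j with u := s }) d.u j.u ∧
    HasDerivAt (fun s => F { j with ut := s }) d.ut j.ut ∧
    HasDerivAt (fun s => F { j with ur := s }) d.ur j.ur ∧
    HasDerivAt (fun s => F { j with utt := s }) d.utt j.utt ∧
    HasDerivAt (fun s => F { j with utr := s }) d.utr j.utr ∧
    HasDerivAt (fun s => F { j with urr := s }) d.urr j.urr ∧
    k.t * d.t + k.r * d.r + k.u * d.u + k.ut * d.ut + k.ur * d.ur + k.utt * d.utt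
      + k.utr * d.utr + k.urr * d.urr = a

namespace HasD

variable {k : Dir} {F G : Jet → ℝ} {j : Jet} {a b : ℝ}

theorem Dt_eq (h : HasD (dirT j) F j a) : Dt F j = a := by
  obtain ⟨d, h1, h2, h3, h4, h5, h6, h7, h8, rfl⟩ := h
  simp only [Dt, dirT, h1.deriv, h3.deriv, h4.deriv, h5.deriv, h6.deriv, h7.deriv, h8.deriv]
  ring

theorem Dr_eq (h : HasD (dirR j) F j a) : Dr F j = a := by
  obtain ⟨d, h1, h2, h3, h4, h5, h6, h7, h8, rfl⟩ := h
  simp only [Dr, dirR, h2.deriv, h3.deriv, h4.deriv, h5.deriv, h6.deriv, h7.deriv, h8.deriv]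
  ring

theorem add (hF : HasD k F j a) (hG : HasD k G j b) : HasD k (fun i => F i + G i) j (a + b) := by
  obtain ⟨d, h1, h2, h3, h4, h5, h6, h7, h8, rfl⟩ := hF
  obtain ⟨e, g1, g2, g3, g4, g5, g6, g7, g8, rfl⟩ := hG
  exact ⟨⟨_, _, _, _, _, _, _, _⟩, h1.add g1, h2.add g2, h3.add g3, h4.add g4, h5.add g5,
    h6.add g6, h7.add g7, h8.add g8, by ring⟩

theorem sub (hF : HasD k F j a) (hG : HasD k G j b) : HasD k (fun i => F i - G i) j (a - b) := by
  obtain ⟨d, h1, h2, h3, h4, h5, h6, h7, h8, rfl⟩ := hF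
  obtain ⟨e, g1, g2, g3, g4, g5, g6, g7, g8, rfl⟩ := hG
  exact ⟨⟨_, _, _, _, _, _, _, _⟩, h1.sub g1, h2.sub g2, h3.sub g3, h4.sub g4, h5.sub g5,
    h6.sub g6, h7.sub g7, h8.sub g8, by ring⟩

theorem mul (hF : HasD k F j a) (hG : HasD k G j b) :
    HasD k (fun i => F i * G i) j (a * G j + F j * b) := by
  obtain ⟨d, h1, h2, h3, h4, h5, h6, h7, h8, rfl⟩ := hF
  obtain ⟨e, g1, g2, g3, g4, g5, g6, g7, g8, rfl⟩ := hG
  exact ⟨⟨_, _, _, _, _, _, _, _⟩, h1.mul g1, h2.mul g2, h3.mul g3, h4.mul g4, h5.mul g5,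
    h6.mul g6, h7.mul g7, h8.mul g8, by ring⟩

theorem coord_ut : HasD k (fun i => i.ut) j k.ut :=
  ⟨⟨0, 0, 0, 1, 0, 0, 0, 0⟩, hasDerivAt_const _ _, hasDerivAt_const _ _, hasDerivAt_const _ _,
    hasDerivAt_id _, hasDerivAt_const _ _, hasDerivAt_const _ _, hasDerivAt_const _ _,
    hasDerivAt_const _ _, by ring⟩

theorem coord_utt : HasD k (fun i => i.utt) j k.utt :=
  ⟨⟨0, 0, 0, 0, 0, 1, 0, 0⟩, hasDerivAt_const _ _, hasDerivAt_const _ _, hasDerivAt_const _ _,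
    hasDerivAt_const _ _, hasDerivAt_const _ _, hasDerivAt_id _, hasDerivAt_const _ _,
    hasDerivAt_const _ _, by ring⟩

theorem coord_utr : HasD k (fun i => i.utr) j k.utr :=
  ⟨⟨0, 0, 0, 0, 0, 0, 1, 0⟩, hasDerivAt_const _ _, hasDerivAt_const _ _, hasDerivAt_const _ _,
    hasDerivAt_const _ _, hasDerivAt_const _ _, hasDerivAt_const _ _, hasDerivAt_id _,
    hasDerivAt_const _ _, by ring⟩

theorem coord_urr : HasD k (fun i => i.urr) j k.urr :=
  ⟨⟨0, 0, 0, 0, 0, 0, 0, 1⟩, hasDerivAt_const _ _, hasDerivAt_const _ _, hasDerivAt_const _ _,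
    hasDerivAt_const _ _, hasDerivAt_const _ _, hasDerivAt_const _ _, hasDerivAt_const _ _,
    hasDerivAt_id _, by ring⟩

theorem comp_r {φ : ℝ → ℝ} {φ' : ℝ} (h : HasDerivAt φ φ' j.r) :
    HasD k (fun i => φ i.r) j (k.r * φ') :=
  ⟨⟨0, φ', 0, 0, 0, 0, 0, 0⟩, hasDerivAt_const _ (φ j.r), h, hasDerivAt_const _ (φ j.r),
    hasDerivAt_const _ (φ j.r), hasDerivAt_const _ (φ j.r), hasDerivAt_const _ (φ j.r), hasDerivAt_const _ (φ j.r),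
    hasDerivAt_const _ (φ j.r), by ring⟩

theorem comp_ur {φ : ℝ → ℝ} {φ' : ℝ} (h : HasDerivAt φ φ' j.ur) :
    HasD k (fun i => φ i.ur) j (k.ur * φ') :=
  ⟨⟨0, 0, 0, 0, φ', 0, 0, 0⟩, hasDerivAt_const _ (φ j.ur), hasDerivAt_const _ (φ j.ur),
    hasDerivAt_const _ (φ j.ur), hasDerivAt_const _ (φ j.ur), h, hasDerivAt_const _ (φ j.ur), hasDerivAt_const _ (φ j.ur),
    hasDerivAt_const _ (φ j.ur), by ring⟩

theorem coord_ur : HasD k (fun i => i.ur) j k.ur := by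
  simpa using comp_ur (k := k) (hasDerivAt_id j.ur)

theorem lift {F : ℝ × ℝ × ℝ → ℝ} (h : DifferentiableAt ℝ F (j.t, j.r, j.u)) :
    HasD k (fun i => F (i.t, i.r, i.u)) j (k.t * dT F (j.t, j.r, j.u)
      + k.r * dR F (j.t, j.r, j.u) + k.u * dU F (j.t, j.r, j.u)) :=
  ⟨⟨_, _, _, 0, 0, 0, 0, 0⟩, hasDerivAt_slice_t h, hasDerivAt_slice_r h, hasDerivAt_slice_u h,
    hasDerivAt_const _ (F (j.t, j.r, j.u)), hasDerivAt_const _ (F (j.t, j.r, j.u)), hasDerivAt_const _ (F (j.t, j.r, j.u)), hasDerivAt_const _ (F (j.t, j.r, j.u)),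
    hasDerivAt_const _ (F (j.t, j.r, j.u)), by simp only [pd]; ring⟩

theorem congr {U : Set (ℝ × ℝ × ℝ)} (hU : IsOpen U) (hj : (j.t, j.r, j.u) ∈ U)
    (hG : HasD k G j a) (h : ∀ i : Jet, (i.t, i.r, i.u) ∈ U → F i = G i) : HasD k F j a := by
  obtain ⟨e, g1, g2, g3, g4, g5, g6, g7, g8, rfl⟩ := hG
  refine ⟨e, g1.congr_of_eventuallyEq ?_, g2.congr_of_eventuallyEq ?_,
    g3.congr_of_eventuallyEq ?_, g4.congr_of_eventuallyEq ?_, g5.congr_of_eventuallyEq ?_,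
    g6.congr_of_eventuallyEq ?_, g7.congr_of_eventuallyEq ?_, g8.congr_of_eventuallyEq ?_, rfl⟩
  · have hc : ContinuousAt (fun s : ℝ => (s, j.r, j.u)) j.t := by fun_prop
    filter_upwards [hc.preimage_mem_nhds (hU.mem_nhds hj)] with s hs using h _ hs
  · have hc : ContinuousAt (fun s : ℝ => (j.t, s, j.u)) j.r := by fun_prop
    filter_upwards [hc.preimage_mem_nhds (hU.mem_nhds hj)] with s hs using h _ hs
  · have hc : ContinuousAt (fun s : ℝ => (j.t, j.r, s)) j.u := by fun_prop
    filter_upwards [hc.preimage_mem_nhds (hU.mem_nhds hj)] with s hs using h _ hs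
  all_goals exact Filter.Eventually.of_forall fun s => h _ hj

end HasD

/-! ### The symmetry condition on solutions -/

/-- The second prolongation of the vector field `T ∂_t + Ξ ∂_r + H ∂_u`, applied to
`u_tt - G(u_r) u_rr - F(u_r)/r` and restricted to the solutions `u_tt = G q + F / r`. The arguments
are the point `x = (t,r,u)`, the values `w, v, s, q` of `u_t, u_r, u_tr, u_rr`, and the values
`G, G', F, F'` of the two functions and their derivatives at `v`. -/
noncomputable def prolong (T Ξ H : ℝ × ℝ × ℝ → ℝ) (x : ℝ × ℝ × ℝ)
    (w v s q G G' F F' : ℝ) : ℝ :=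
  (dT (dT H) x + 2 * w * dT (dU H) x + w ^ 2 * dU (dU H) x + (G * q + F / x.2.1) * dU H x
    - w * (dT (dT T) x + 2 * w * dT (dU T) x + w ^ 2 * dU (dU T) x
      + (G * q + F / x.2.1) * dU T x)
    - v * (dT (dT Ξ) x + 2 * w * dT (dU Ξ) x + w ^ 2 * dU (dU Ξ) x
      + (G * q + F / x.2.1) * dU Ξ x)
    - 2 * (G * q + F / x.2.1) * (dT T x + w * dU T x) - 2 * s * (dT Ξ x + w * dU Ξ x))
  - G * (dR (dR H) x + 2 * v * dR (dU H) x + v ^ 2 * dU (dU H) x + q * dU H x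
    - w * (dR (dR T) x + 2 * v * dR (dU T) x + v ^ 2 * dU (dU T) x + q * dU T x)
    - v * (dR (dR Ξ) x + 2 * v * dR (dU Ξ) x + v ^ 2 * dU (dU Ξ) x + q * dU Ξ x)
    - 2 * s * (dR T x + v * dU T x) - 2 * q * (dR Ξ x + v * dU Ξ x))
  - (F' / x.2.1 + q * G') * (dR H x + v * dU H x - w * (dR T x + v * dU T x)
    - v * (dR Ξ x + v * dU Ξ x))
  + Ξ x * F / x.2.1 ^ 2

section

variable {U : Set (ℝ × ℝ × ℝ)} {T Ξ H : ℝ × ℝ × ℝ → ℝ}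

/-- The characteristic function of the vector field with components `T, Ξ, H`. -/
def charOf (T Ξ H : ℝ × ℝ × ℝ → ℝ) (i : Jet) : ℝ :=
  H (i.t, i.r, i.u) - T (i.t, i.r, i.u) * i.ut - Ξ (i.t, i.r, i.u) * i.ur

theorem Dt_charOf (hU : IsOpen U) (hT : ContDiffOn ℝ (⊤ : ℕ∞) T U)
    (hΞ : ContDiffOn ℝ (⊤ : ℕ∞) Ξ U) (hH : ContDiffOn ℝ (⊤ : ℕ∞) H U) (i : Jet)
    (hi : (i.t, i.r, i.u) ∈ U) :
    Dt (charOf T Ξ H) i = dT H (i.t, i.r, i.u) + i.ut * dU H (i.t, i.r, i.u)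
      - ((dT T (i.t, i.r, i.u) + i.ut * dU T (i.t, i.r, i.u)) * i.ut
        + T (i.t, i.r, i.u) * i.utt)
      - ((dT Ξ (i.t, i.r, i.u) + i.ut * dU Ξ (i.t, i.r, i.u)) * i.ur
        + Ξ (i.t, i.r, i.u) * i.utr) := by
  have h := (((HasD.lift (differentiableAt_of_contDiffOn hU hH hi)).sub
    ((HasD.lift (differentiableAt_of_contDiffOn hU hT hi)).mul HasD.coord_ut)).sub
    ((HasD.lift (differentiableAt_of_contDiffOn hU hΞ hi)).mul HasD.coord_ur) :
      HasD (dirT i) (charOf T Ξ H) i _)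
  refine h.Dt_eq.trans ?_
  simp only [dirT]
  ring

theorem Dr_charOf (hU : IsOpen U) (hT : ContDiffOn ℝ (⊤ : ℕ∞) T U)
    (hΞ : ContDiffOn ℝ (⊤ : ℕ∞) Ξ U) (hH : ContDiffOn ℝ (⊤ : ℕ∞) H U) (i : Jet)
    (hi : (i.t, i.r, i.u) ∈ U) :
    Dr (charOf T Ξ H) i = dR H (i.t, i.r, i.u) + i.ur * dU H (i.t, i.r, i.u)
      - ((dR T (i.t, i.r, i.u) + i.ur * dU T (i.t, i.r, i.u)) * i.ut
        + T (i.t, i.r, i.u) * i.utr)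
      - ((dR Ξ (i.t, i.r, i.u) + i.ur * dU Ξ (i.t, i.r, i.u)) * i.ur
        + Ξ (i.t, i.r, i.u) * i.urr) := by
  have h := (((HasD.lift (differentiableAt_of_contDiffOn hU hH hi)).sub
    ((HasD.lift (differentiableAt_of_contDiffOn hU hT hi)).mul HasD.coord_ut)).sub
    ((HasD.lift (differentiableAt_of_contDiffOn hU hΞ hi)).mul HasD.coord_ur) :
      HasD (dirR i) (charOf T Ξ H) i _)
  refine h.Dr_eq.trans ?_
  simp only [dirR]
  ring

theorem Dt_Dt_charOf (hU : IsOpen U) (hT : ContDiffOn ℝ (⊤ : ℕ∞) T U)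
    (hΞ : ContDiffOn ℝ (⊤ : ℕ∞) Ξ U) (hH : ContDiffOn ℝ (⊤ : ℕ∞) H U) (j : Jet)
    {x : ℝ × ℝ × ℝ} (hjx : x = (j.t, j.r, j.u)) (hx : x ∈ U) :
    Dt (Dt (charOf T Ξ H)) j =
      dT (dT H) x + 2 * j.ut * dT (dU H) x + j.ut ^ 2 * dU (dU H) x + j.utt * dU H x
      - j.ut * (dT (dT T) x + 2 * j.ut * dT (dU T) x + j.ut ^ 2 * dU (dU T) x + j.utt * dU T x)
      - j.ur * (dT (dT Ξ) x + 2 * j.ut * dT (dU Ξ) x + j.ut ^ 2 * dU (dU Ξ) x + j.utt * dU Ξ x)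
      - 2 * j.utt * (dT T x + j.ut * dU T x) - 2 * j.utr * (dT Ξ x + j.ut * dU Ξ x)
      - T x * j.uttt - Ξ x * j.uttr := by
  subst hjx
  have dif {F : ℝ × ℝ × ℝ → ℝ} (hF : ContDiffOn ℝ (⊤ : ℕ∞) F U) :=
    HasD.lift (k := dirT j) (differentiableAt_of_contDiffOn hU hF hx)
  have h := ((((dif (contDiffOn_pd hU hH (1, 0, 0))).add
      (HasD.coord_ut.mul (dif (contDiffOn_pd hU hH (0, 0, 1))))).sub
    ((((dif (contDiffOn_pd hU hT (1, 0, 0))).add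
      (HasD.coord_ut.mul (dif (contDiffOn_pd hU hT (0, 0, 1))))).mul HasD.coord_ut).add
      ((dif hT).mul HasD.coord_utt))).sub
    ((((dif (contDiffOn_pd hU hΞ (1, 0, 0))).add
      (HasD.coord_ut.mul (dif (contDiffOn_pd hU hΞ (0, 0, 1))))).mul HasD.coord_ur).add
      ((dif hΞ).mul HasD.coord_utr))).congr hU hx (F := Dt (charOf T Ξ H))
    (Dt_charOf hU hT hΞ hH)
  rw [h.Dt_eq]
  simp only [dirT, dT, dU]
  rw [pd_comm hU hH hx (0, 0, 1) (1, 0, 0), pd_comm hU hT hx (0, 0, 1) (1, 0, 0),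
    pd_comm hU hΞ hx (0, 0, 1) (1, 0, 0)]
  ring

theorem Dr_Dr_charOf (hU : IsOpen U) (hT : ContDiffOn ℝ (⊤ : ℕ∞) T U)
    (hΞ : ContDiffOn ℝ (⊤ : ℕ∞) Ξ U) (hH : ContDiffOn ℝ (⊤ : ℕ∞) H U) (j : Jet)
    {x : ℝ × ℝ × ℝ} (hjx : x = (j.t, j.r, j.u)) (hx : x ∈ U) :
    Dr (Dr (charOf T Ξ H)) j =
      dR (dR H) x + 2 * j.ur * dR (dU H) x + j.ur ^ 2 * dU (dU H) x + j.urr * dU H x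
      - j.ut * (dR (dR T) x + 2 * j.ur * dR (dU T) x + j.ur ^ 2 * dU (dU T) x + j.urr * dU T x)
      - j.ur * (dR (dR Ξ) x + 2 * j.ur * dR (dU Ξ) x + j.ur ^ 2 * dU (dU Ξ) x + j.urr * dU Ξ x)
      - 2 * j.utr * (dR T x + j.ur * dU T x) - 2 * j.urr * (dR Ξ x + j.ur * dU Ξ x)
      - T x * j.utrr - Ξ x * j.urrr := by
  subst hjx
  have dif {F : ℝ × ℝ × ℝ → ℝ} (hF : ContDiffOn ℝ (⊤ : ℕ∞) F U) :=
    HasD.lift (k := dirR j) (differentiableAt_of_contDiffOn hU hF hx)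
  have h := ((((dif (contDiffOn_pd hU hH (0, 1, 0))).add
      (HasD.coord_ur.mul (dif (contDiffOn_pd hU hH (0, 0, 1))))).sub
    ((((dif (contDiffOn_pd hU hT (0, 1, 0))).add
      (HasD.coord_ur.mul (dif (contDiffOn_pd hU hT (0, 0, 1))))).mul HasD.coord_ut).add
      ((dif hT).mul HasD.coord_utr))).sub
    ((((dif (contDiffOn_pd hU hΞ (0, 1, 0))).add
      (HasD.coord_ur.mul (dif (contDiffOn_pd hU hΞ (0, 0, 1))))).mul HasD.coord_ur).add
      ((dif hΞ).mul HasD.coord_urr))).congr hU hx (F := Dr (charOf T Ξ H))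
    (Dr_charOf hU hT hΞ hH)
  rw [h.Dr_eq]
  simp only [dirR, dR, dU]
  rw [pd_comm hU hH hx (0, 0, 1) (0, 1, 0), pd_comm hU hT hx (0, 0, 1) (0, 1, 0),
    pd_comm hU hΞ hx (0, 0, 1) (0, 1, 0)]
  ring

variable {G F : ℝ → ℝ} {G' F' : ℝ}

theorem hasD_waveOp (k : Dir) (j : Jet) (hr : j.r ≠ 0) (hG : HasDerivAt G G' j.ur)
    (hF : HasDerivAt F F' j.ur) :
    HasD k (waveOp (fun _ _ v => G v) (fun r _ v => F v / r)) j
      (k.utt - (k.ur * G' * j.urr + G j.ur * k.urr)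
        - (k.ur * F' * j.r⁻¹ + F j.ur * (k.r * -(j.r ^ 2)⁻¹))) :=
  (HasD.coord_utt.sub ((HasD.comp_ur hG).mul HasD.coord_urr)).sub
    ((HasD.comp_ur hF).mul (HasD.comp_r (hasDerivAt_inv hr)))

/-- On jets satisfying the wave equation and its differential consequences, the linearized
operator on the characteristic function is the prolonged vector field applied to the equation:
the third-order derivatives enter only through `T D_tΔ + Ξ D_rΔ`. -/
theorem linWaveOp_charOf (hU : IsOpen U) (hT : ContDiffOn ℝ (⊤ : ℕ∞) T U)
    (hΞ : ContDiffOn ℝ (⊤ : ℕ∞) Ξ U) (hH : ContDiffOn ℝ (⊤ : ℕ∞) H U) (j : Jet)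
    (hx : (j.t, j.r, j.u) ∈ U) (hr : j.r ≠ 0) (hG : HasDerivAt G G' j.ur)
    (hF : HasDerivAt F F' j.ur)
    (h0 : waveOp (fun _ _ v => G v) (fun r _ v => F v / r) j = 0)
    (ht : Dt (waveOp (fun _ _ v => G v) (fun r _ v => F v / r)) j = 0)
    (hr' : Dr (waveOp (fun _ _ v => G v) (fun r _ v => F v / r)) j = 0) :
    linWaveOp (fun _ _ v => G v) (fun r _ v => F v / r) (charOf T Ξ H) j =
      prolong T Ξ H (j.t, j.r, j.u) j.ut j.ur j.utr j.urr (G j.ur) G' (F j.ur) F' := by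
  rw [(hasD_waveOp _ j hr hG hF).Dt_eq] at ht
  rw [(hasD_waveOp _ j hr hG hF).Dr_eq] at hr'
  have hF' : deriv (fun s => F s / j.r) j.ur = F' / j.r := (hF.div_const _).deriv
  have h0' : j.utt = G j.ur * j.urr + F j.ur / j.r := by
    simp only [waveOp] at h0; linear_combination h0
  simp only [dirT, dirR] at ht hr'
  simp only [linWaveOp, Dt_Dt_charOf hU hT hΞ hH j rfl hx, Dr_Dr_charOf hU hT hΞ hH j rfl hx,
    Dr_charOf hU hT hΞ hH j hx, hG.deriv, hF', deriv_const, prolong, ← h0']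
  linear_combination (-T (j.t, j.r, j.u)) * ht - Ξ (j.t, j.r, j.u) * hr'

/-- The point symmetry condition, with the constraints on jets solved for `u_tt, u_ttt, u_ttr`. -/
theorem isPointSymmetry_iff (hU : IsOpen U) (hUr : ∀ x ∈ U, 0 < x.2.1) {V : Set ℝ}
    (G F G' F' : ℝ → ℝ) (hG : ∀ v ∈ V, HasDerivAt G (G' v) v)
    (hF : ∀ v ∈ V, HasDerivAt F (F' v) v) :
    IsPointSymmetry (fun _ _ v => G v) (fun r _ v => F v / r) U V (fun x => (T x, Ξ x, H x)) ↔
      (ContDiffOn ℝ (⊤ : ℕ∞) T U ∧ ContDiffOn ℝ (⊤ : ℕ∞) Ξ U ∧ ContDiffOn ℝ (⊤ : ℕ∞) H U) ∧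
      ∀ x ∈ U, ∀ v ∈ V, ∀ w s q, prolong T Ξ H x w v s q (G v) (G' v) (F v) (F' v) = 0 := by
  have key : charFn (fun x => (T x, Ξ x, H x)) = charOf T Ξ H := rfl
  rw [IsPointSymmetry, key]
  constructor
  · rintro ⟨hs, h⟩
    have hT : ContDiffOn ℝ (⊤ : ℕ∞) T U := hs.fst
    have hΞ : ContDiffOn ℝ (⊤ : ℕ∞) Ξ U := hs.snd.fst
    have hH : ContDiffOn ℝ (⊤ : ℕ∞) H U := hs.snd.snd
    refine ⟨⟨hT, hΞ, hH⟩, fun x hx v hv w s q => ?_⟩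
    have hr := (hUr x hx).ne'
    -- `u_tt`, `u_ttt`, `u_ttr` are forced; `u_trr` and `u_rrr` are free and set to zero.
    let j : Jet := ⟨x.1, x.2.1, x.2.2, w, v, G v * q + F v / x.2.1, s, q,
      (q * G' v + F' v / x.2.1) * s, (q * G' v + F' v / x.2.1) * q - F v / x.2.1 ^ 2, 0, 0⟩
    have h0 : waveOp (fun _ _ v => G v) (fun r _ v => F v / r) j = 0 := by
      simp only [waveOp, j]; ring
    have ht : Dt (waveOp (fun _ _ v => G v) (fun r _ v => F v / r)) j = 0 := by
      rw [(hasD_waveOp _ j hr (hG v hv) (hF v hv)).Dt_eq]; simp only [dirT, j]; ring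
    have hr' : Dr (waveOp (fun _ _ v => G v) (fun r _ v => F v / r)) j = 0 := by
      rw [(hasD_waveOp _ j hr (hG v hv) (hF v hv)).Dr_eq]; simp only [dirR, j]; ring
    exact (linWaveOp_charOf hU hT hΞ hH j hx hr (hG v hv) (hF v hv) h0 ht hr').symm.trans
      (h j hx hv h0 ht hr')
  · rintro ⟨⟨hT, hΞ, hH⟩, h⟩
    refine ⟨hT.prodMk (hΞ.prodMk hH), fun j hx hv h0 ht hr' => ?_⟩
    rw [linWaveOp_charOf hU hT hΞ hH j hx (hUr _ hx).ne' (hG _ hv) (hF _ hv) h0 ht hr']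
    exact h _ hx _ hv _ _ _

end

/-! ### Independence of the powers of `u_r` -/

section Powers

variable {p v : ℝ}

/-- For negative `v` the real power with exponent `p` is `|v|^p cos(π p)`, which is nonzero because
`p` is an integer there. -/
theorem rpow_ne_zero_of_mem_powDomain (hv : v ∈ powDomain p) (h0 : v ≠ 0) : v ^ p ≠ 0 := by
  rcases hv with h | ⟨_, k, rfl⟩ | ⟨k, rfl⟩
  · exact (Real.rpow_pos_of_pos h p).ne'
  · rw [Real.rpow_intCast]; exact zpow_ne_zero _ h0
  · rw [Real.rpow_natCast]; exact pow_ne_zero _ h0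

theorem ne_zero_or_one_le_of_mem_powDomain (hv : v ∈ powDomain p) (hp : p ≠ 0) :
    v ≠ 0 ∨ 1 ≤ p := by
  rcases hv with h | ⟨h, _⟩ | ⟨k, rfl⟩
  · exact Or.inl h.ne'
  · exact Or.inl h
  · exact Or.inr (by exact_mod_cast Nat.one_le_iff_ne_zero.2 (by exact_mod_cast hp))

theorem rpow_add_one_eq (hp1 : p ≠ -1) : v ^ (p + 1) = v * v ^ p := by
  by_cases h0 : v = 0
  · subst h0
    rw [Real.zero_rpow (fun h => hp1 (by linarith))]; ring
  · rw [Real.rpow_add_one h0]; ring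

theorem mul_rpow_sub_one (hp : p ≠ 0) : v * v ^ (p - 1) = v ^ p := by
  by_cases h0 : v = 0
  · subst h0
    rw [Real.zero_rpow hp]; ring
  · rw [Real.rpow_sub_one h0]; field_simp

theorem exists_isOpen_subset_ne_zero {V : Set ℝ} (hV : IsOpen V) (hVn : V.Nonempty) :
    ∃ W ⊆ V, IsOpen W ∧ W.Nonempty ∧ ∀ v ∈ W, v ≠ 0 := by
  refine ⟨V ∩ {0}ᶜ, Set.inter_subset_left, hV.inter isOpen_compl_singleton, ?_, fun v hv => hv.2⟩
  exact (dense_compl_singleton (0 : ℝ)).inter_open_nonempty V hV hVn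

/-- Applying the Euler operator `v d/dv` to a vanishing combination of `1, v, v^p, v^{p+1}`. -/
theorem euler_of_combination_eq_zero {V : Set ℝ} (hV : IsOpen V) (h0 : ∀ v ∈ V, v ≠ 0)
    {a₀ a₁ a₂ a₃ : ℝ} (h : ∀ v ∈ V, a₀ + a₁ * v + a₂ * v ^ p + a₃ * (v * v ^ p) = 0) :
    ∀ v ∈ V, a₁ * v + p * a₂ * v ^ p + (p + 1) * a₃ * (v * v ^ p) = 0 := by
  intro v hv
  have hd : HasDerivAt (fun v : ℝ => v ^ p) (p * v ^ (p - 1)) v :=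
    Real.hasDerivAt_rpow_const (Or.inl (h0 v hv))
  have h1 : HasDerivAt (fun v : ℝ => a₀ + a₁ * v + a₂ * v ^ p + a₃ * (v * v ^ p))
      (a₁ * 1 + a₂ * (p * v ^ (p - 1)) + a₃ * (1 * v ^ p + v * (p * v ^ (p - 1)))) v :=
    ((((hasDerivAt_id v).const_mul a₁).const_add a₀).add (hd.const_mul a₂)).add
      (((hasDerivAt_id v).mul hd).const_mul a₃)
  have h2 : HasDerivAt (fun v : ℝ => a₀ + a₁ * v + a₂ * v ^ p + a₃ * (v * v ^ p)) 0 v :=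
    (hasDerivAt_const v (0 : ℝ)).congr_of_eventuallyEq
      (Filter.eventuallyEq_of_mem (hV.mem_nhds hv) h)
  have h3 := h1.unique h2
  rw [Real.rpow_sub_one (h0 v hv)] at h3
  have := h0 v hv
  field_simp at h3
  linear_combination h3

/-- Linear independence of `1, v, v^p, v^{p+1}` on a nonempty open set. For `p = 1` the second and
third functions coincide, and only the sum of their coefficients is determined. -/
theorem coeffs_of_combination_eq_zero {V : Set ℝ} (hV : IsOpen V) (hVn : V.Nonempty)
    (hVp : V ⊆ powDomain p) (hp : p ≠ 0) (hp1 : p ≠ -1) {a₀ a₁ a₂ a₃ : ℝ}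
    (h : ∀ v ∈ V, v ≠ 0 → a₀ + a₁ * v + a₂ * v ^ p + a₃ * (v * v ^ p) = 0) :
    a₀ = 0 ∧ a₃ = 0 ∧ (p ≠ 1 → a₁ = 0 ∧ a₂ = 0) ∧ (p = 1 → a₁ + a₂ = 0) := by
  obtain ⟨W, hWV, hW, ⟨v, hv⟩, hW0⟩ := exists_isOpen_subset_ne_zero hV hVn
  have h' : ∀ v ∈ W, a₀ + a₁ * v + a₂ * v ^ p + a₃ * (v * v ^ p) = 0 :=
    fun v hv => h v (hWV hv) (hW0 v hv)
  have e1 := euler_of_combination_eq_zero hW hW0 h'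
  -- Subtracting the first and second Euler derivatives removes `1` and `v`, and leaves
  -- `p v^p` times an affine function of `v`.
  have e2 := euler_of_combination_eq_zero (p := p) hW hW0 (a₀ := 0) (a₁ := a₁) (a₂ := p * a₂)
    (a₃ := (p + 1) * a₃) (fun v hv => by linear_combination e1 v hv)
  have e3 : ∀ v ∈ W, (p - 1) * a₂ + (p + 1) * a₃ * v = 0 := fun v hv => by
    have hφ := rpow_ne_zero_of_mem_powDomain (hVp (hWV hv)) (hW0 v hv)
    refine (mul_eq_zero.1 (?_ : (p * v ^ p) * ((p - 1) * a₂ + (p + 1) * a₃ * v) = 0)).resolve_left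
      (mul_ne_zero hp hφ)
    linear_combination e2 v hv - e1 v hv
  -- The Euler operator once more, on an affine function.
  have e4 : (p + 1) * a₃ * v = 0 := by
    have := euler_of_combination_eq_zero (p := 1) hW hW0 (a₀ := (p - 1) * a₂)
      (a₁ := (p + 1) * a₃) (a₂ := 0) (a₃ := 0)
      (fun v hv => by linear_combination e3 v hv) v hv
    linear_combination this
  have h3 : a₃ = 0 := by
    simpa [hW0 v hv, show p + 1 ≠ 0 from fun h => hp1 (by linarith)] using e4
  have h2 : (p - 1) * a₂ = 0 := by linear_combination e3 v hv - e4
  have h0 : a₀ = 0 := by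
    linear_combination h' v hv - e1 v hv + h2 * v ^ p + p * (v * v ^ p) * h3
  refine ⟨h0, h3, fun hne => ?_, fun h1 => ?_⟩
  · have h2 : a₂ = 0 := (mul_eq_zero.1 h2).resolve_left (sub_ne_zero.2 hne)
    refine ⟨(mul_eq_zero.1 (?_ : a₁ * v = 0)).resolve_right (hW0 v hv), h2⟩
    linear_combination e1 v hv - p * v ^ p * h2 - (p + 1) * (v * v ^ p) * h3
  · subst h1
    refine (mul_eq_zero.1 (?_ : (a₁ + a₂) * v = 0)).resolve_right (hW0 v hv)
    have := e1 v hv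
    rw [Real.rpow_one] at this
    linear_combination this - 2 * v * v * h3

end Powers

/-! ### The determining system -/

section Coefficients

variable {a b c p n v : ℝ}

theorem hasDerivAt_gB (hv : v ∈ powDomain p) (hp : p ≠ 0) :
    HasDerivAt (fun v : ℝ => c + (a + b) * v ^ p) ((a + b) * (p * v ^ (p - 1))) v :=
  ((Real.hasDerivAt_rpow_const
    (ne_zero_or_one_le_of_mem_powDomain hv hp)).const_mul _).const_add _

theorem hasDerivAt_fB (hv : v ∈ powDomain p) (hp : p ≠ 0) :
    HasDerivAt (fun v : ℝ => (n - 1) * (c * v + b * v ^ (p + 1)))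
      ((n - 1) * (c + b * ((p + 1) * v ^ p))) v := by
  have h : HasDerivAt (fun v : ℝ => v ^ (p + 1)) ((p + 1) * v ^ (p + 1 - 1)) v :=
    Real.hasDerivAt_rpow_const
      ((ne_zero_or_one_le_of_mem_powDomain hv hp).imp_right fun h => by linarith)
  rw [add_sub_cancel_right] at h
  simpa using (((hasDerivAt_id v).const_mul c).add (h.const_mul b)).const_mul (n - 1)

end Coefficients

/-- The determining system of the point symmetries `T ∂_t + Ξ ∂_r + H ∂_u` on `U`. -/
structure IsDetSolution (n a b c p : ℝ) (U : Set (ℝ × ℝ × ℝ)) (T Ξ H : ℝ × ℝ × ℝ → ℝ) : Prop where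
  T_r : ∀ x ∈ U, dR T x = 0
  T_u : ∀ x ∈ U, dU T x = 0
  Ξ_t : ∀ x ∈ U, dT Ξ x = 0
  Ξ_u : ∀ x ∈ U, dU Ξ x = 0
  H_r : ∀ x ∈ U, dR H x = 0
  H_uu : ∀ x ∈ U, dU (dU H) x = 0
  H_tt : ∀ x ∈ U, dT (dT H) x = 0
  H_tu : ∀ x ∈ U, 2 * dT (dU H) x = dT (dT T) x
  H_u : ∀ x ∈ U, p * (dU H x - dR Ξ x) = 2 * (dR Ξ x - dT T x)
  c_eq : ∀ x ∈ U, c * (dR Ξ x - dT T x) = 0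
  Ξ_rr : ∀ x ∈ U, (a + b) * x.2.1 ^ 2 * dR (dR Ξ) x = b * (n - 1) * (x.2.1 * dR Ξ x - Ξ x)

section Determining

variable {n a b c p : ℝ} {U : Set (ℝ × ℝ × ℝ)} {V : Set ℝ} {T Ξ H : ℝ × ℝ × ℝ → ℝ}

/-- The point symmetry condition for the powers in `gB`, `fB`. -/
theorem isPointSymmetry_gB_fB_iff (hp : p ≠ 0)
    (hU : IsOpen U) (hUr : ∀ x ∈ U, 0 < x.2.1) (hVp : V ⊆ powDomain p) :
    IsPointSymmetry (gB a b c p) (fB n b c p) U V (fun x => (T x, Ξ x, H x)) ↔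
      (ContDiffOn ℝ (⊤ : ℕ∞) T U ∧ ContDiffOn ℝ (⊤ : ℕ∞) Ξ U ∧ ContDiffOn ℝ (⊤ : ℕ∞) H U) ∧
      ∀ x ∈ U, ∀ v ∈ V, ∀ w s q, prolong T Ξ H x w v s q (c + (a + b) * v ^ p)
        ((a + b) * (p * v ^ (p - 1))) ((n - 1) * (c * v + b * v ^ (p + 1)))
        ((n - 1) * (c + b * ((p + 1) * v ^ p))) = 0 :=
  isPointSymmetry_iff hU hUr (fun v : ℝ => c + (a + b) * v ^ p)
    (fun v : ℝ => (n - 1) * (c * v + b * v ^ (p + 1))) (fun v => (a + b) * (p * v ^ (p - 1)))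
    (fun v => (n - 1) * (c + b * ((p + 1) * v ^ p)))
    (fun _ hv => hasDerivAt_gB (hVp hv) hp) (fun _ hv => hasDerivAt_fB (hVp hv) hp)

/-- Solutions of the determining system are point symmetries. -/
theorem IsDetSolution.prolong_eq_zero (hn : n ≠ 1) (hb : b ≠ 0) (hp : p ≠ 0) (hp1 : p ≠ -1)
    (hU : IsOpen U) (hUr : ∀ x ∈ U, 0 < x.2.1) (hT : ContDiffOn ℝ (⊤ : ℕ∞) T U)
    (hH : ContDiffOn ℝ (⊤ : ℕ∞) H U)
    (h : IsDetSolution n a b c p U T Ξ H) {x : ℝ × ℝ × ℝ} (hx : x ∈ U) (w v s q : ℝ) :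
    prolong T Ξ H x w v s q (c + (a + b) * v ^ p)
        ((a + b) * (p * v ^ (p - 1))) ((n - 1) * (c * v + b * v ^ (p + 1)))
        ((n - 1) * (c + b * ((p + 1) * v ^ p))) = 0 := by
  have hr := (hUr x hx).ne'
  have H_rr : dR (dR H) x = 0 := pd_eq_zero hU h.H_r hx _
  have H_ru : dR (dU H) x = 0 := (pd_comm hU hH hx _ _).trans (pd_eq_zero hU h.H_r hx _)
  have T_rr : dR (dR T) x = 0 := pd_eq_zero hU h.T_r hx _
  have T_ru : dR (dU T) x = 0 := pd_eq_zero hU h.T_u hx _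
  have T_tu : dT (dU T) x = 0 := pd_eq_zero hU h.T_u hx _
  have T_uu : dU (dU T) x = 0 := pd_eq_zero hU h.T_u hx _
  have T_tr : dR (dT T) x = 0 := (pd_comm hU hT hx _ _).trans (pd_eq_zero hU h.T_r hx _)
  have Ξ_tt : dT (dT Ξ) x = 0 := pd_eq_zero hU h.Ξ_t hx _
  have Ξ_tu : dT (dU Ξ) x = 0 := pd_eq_zero hU h.Ξ_u hx _
  have Ξ_ru : dR (dU Ξ) x = 0 := pd_eq_zero hU h.Ξ_u hx _
  have Ξ_uu : dU (dU Ξ) x = 0 := pd_eq_zero hU h.Ξ_u hx _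
  have e1 : (a + b) * dR (dR Ξ) x = b * (n - 1) * (dR Ξ x / x.2.1 - Ξ x / x.2.1 ^ 2) := by
    have := h.Ξ_rr x hx
    field_simp
    linear_combination this
  -- For `c ≠ 0`, the coefficient of `v` vanishes because `Ξ_r = T_t` does not depend on `r`, so
  -- that the Euler equation reduces to `r Ξ_r = Ξ`.
  have hc1 : c * dR (dR Ξ) x = 0 := by
    by_cases hc : c = 0
    · simp [hc]
    · have : dR (dR Ξ) x = dR (dT T) x :=
        pd_congr hU (fun y hy => sub_eq_zero.1 ((mul_eq_zero.1 (h.c_eq y hy)).resolve_left hc)) hx _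
      rw [this, T_tr, mul_zero]
  have hc2 : c * (dR Ξ x / x.2.1 - Ξ x / x.2.1 ^ 2) = 0 := by
    refine (mul_eq_zero.1 (?_ : (b * (n - 1)) * _ = 0)).resolve_left
      (mul_ne_zero hb (sub_ne_zero.2 hn))
    linear_combination (a + b) * hc1 - c * e1
  rw [rpow_add_one_eq hp1]
  unfold prolong
  rw [h.H_uu x hx, h.H_tt x hx, h.H_r x hx, h.T_r x hx, h.T_u x hx, h.Ξ_t x hx, h.Ξ_u x hx,
    H_rr, H_ru, T_rr, T_ru, T_tu, T_uu, Ξ_tt, Ξ_tu, Ξ_ru, Ξ_uu]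
  linear_combination w * h.H_tu x hx + q * (2 * h.c_eq x hx - (a + b) * v ^ p * h.H_u x hx)
    + v * (hc1 + (n - 1) / x.2.1 * (2 * h.c_eq x hx) - (n - 1) * hc2)
    + v * v ^ p * (e1 - b * (n - 1) / x.2.1 * h.H_u x hx)
    - q * (a + b) * p * (dU H x - dR Ξ x) * mul_rpow_sub_one (v := v) hp

/-- The conditions at a single point obtained by splitting the symmetry condition with respect to
`u_tr` and then `u_t`, `u_r`. -/
theorem first_order_of_prolong_eq_zero (hab : a + b ≠ 0) (hp : p ≠ 0) (hp1 : p ≠ -1)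
    (hV : IsOpen V) (hVn : V.Nonempty) (hVp : V ⊆ powDomain p) {x : ℝ × ℝ × ℝ} {G' F F' : ℝ → ℝ}
    (h : ∀ v ∈ V, ∀ w s q,
      prolong T Ξ H x w v s q (c + (a + b) * v ^ p) (G' v) (F v) (F' v) = 0) :
    dR T x = 0 ∧ dU T x = 0 ∧ dT Ξ x = 0 ∧ dU Ξ x = 0 := by
  have h1 : ∀ v ∈ V, ∀ w,
      -(dT Ξ x + w * dU Ξ x) + (c + (a + b) * v ^ p) * (dR T x + v * dU T x) = 0 := by
    intro v hv w
    have e0 := h v hv w 0 0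
    have e1 := h v hv w 1 0
    simp only [prolong] at e0 e1
    linear_combination (e1 - e0) / 2
  obtain ⟨v₀, hv₀⟩ := hVn
  have hu : dU Ξ x = 0 := by linear_combination h1 v₀ hv₀ 0 - h1 v₀ hv₀ 1
  obtain ⟨k0, k3, k12, kp⟩ := coeffs_of_combination_eq_zero (p := p) hV ⟨v₀, hv₀⟩ hVp hp hp1
    (a₀ := c * dR T x - dT Ξ x) (a₁ := c * dU T x) (a₂ := (a + b) * dR T x)
    (a₃ := (a + b) * dU T x) (fun v hv _ => by linear_combination h1 v hv 0)
  have hTu : dU T x = 0 := (mul_eq_zero.1 k3).resolve_left hab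
  have hTr : dR T x = 0 := by
    refine (mul_eq_zero.1 (?_ : (a + b) * _ = 0)).resolve_left hab
    by_cases h1 : p = 1
    · linear_combination kp h1 - c * hTu
    · exact (k12 h1).2
  exact ⟨hTr, hTu, by linear_combination c * hTr - k0, hu⟩

/-- The remaining conditions at a single point, obtained by splitting the symmetry condition with
respect to `u_rr, u_t, u_r` when `T` depends only on `t` and `Ξ` only on `r`. For `p = 1` the
functions `v` and `v^p` coincide, which leaves fewer equations. -/
theorem second_order_of_prolong_eq_zero (hp : p ≠ 0) (hp1 : p ≠ -1) (hab : a + b ≠ 0)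
    (hV : IsOpen V) (hVn : V.Nonempty) (hVp : V ⊆ powDomain p) {x : ℝ × ℝ × ℝ}
    (h : ∀ v ∈ V, ∀ w s q, prolong T Ξ H x w v s q (c + (a + b) * v ^ p)
        ((a + b) * (p * v ^ (p - 1))) ((n - 1) * (c * v + b * v ^ (p + 1)))
        ((n - 1) * (c + b * ((p + 1) * v ^ p))) = 0)
    (T_r : dR T x = 0) (T_u : dU T x = 0) (Ξ_t : dT Ξ x = 0) (Ξ_u : dU Ξ x = 0)
    (T_rr : dR (dR T) x = 0) (T_ru : dR (dU T) x = 0) (T_tu : dT (dU T) x = 0)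
    (T_uu : dU (dU T) x = 0) (Ξ_tt : dT (dT Ξ) x = 0) (Ξ_tu : dT (dU Ξ) x = 0)
    (Ξ_ru : dR (dU Ξ) x = 0) (Ξ_uu : dU (dU Ξ) x = 0) :
    dU (dU H) x = 0 ∧ 2 * dT (dU H) x = dT (dT T) x ∧
    p * (dU H x - dR Ξ x) = 2 * (dR Ξ x - dT T x) ∧
    (p ≠ 1 → c * (dR Ξ x - dT T x) = 0 ∧ dR H x = 0) ∧
    (p = 1 → (a + b) * dR H x = 2 * c * (dR Ξ x - dT T x)) ∧
    dT (dT H) x = c * dR (dR H) x + (n - 1) / x.2.1 * c * dR H x ∧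
    (n - 1) / x.2.1 * b * (dU H x - 2 * dT T x - (p + 1) * (dU H x - dR Ξ x) + Ξ x / x.2.1)
      - 2 * (a + b) * dR (dU H) x + (a + b) * dR (dR Ξ) x = 0 := by
  have key : ∀ v ∈ V, ∀ w q, dT (dT H) x + w * (2 * dT (dU H) x - dT (dT T) x)
      + w ^ 2 * dU (dU H) x
      + ((c + (a + b) * v ^ p) * q + (n - 1) / x.2.1 * (c * v + b * (v * v ^ p)))
        * (dU H x - 2 * dT T x)
      - (c + (a + b) * v ^ p) * (dR (dR H) x + 2 * v * dR (dU H) x + v ^ 2 * dU (dU H) x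
        + q * dU H x - v * dR (dR Ξ) x - 2 * q * dR Ξ x)
      - ((n - 1) / x.2.1 * (c + b * ((p + 1) * v ^ p)) + q * ((a + b) * (p * v ^ (p - 1))))
        * (dR H x + v * (dU H x - dR Ξ x))
      + Ξ x / x.2.1 * ((n - 1) / x.2.1 * (c * v + b * (v * v ^ p))) = 0 := by
    intro v hv w q
    have e := h v hv w 0 q
    simp only [prolong, rpow_add_one_eq hp1, T_r, T_u, Ξ_t, Ξ_u, T_rr, T_ru, T_tu, T_uu, Ξ_tt,
      Ξ_tu, Ξ_ru, Ξ_uu] at e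
    linear_combination e
  obtain ⟨v₀, hv₀⟩ := hVn
  have H_uu : dU (dU H) x = 0 := by
    linear_combination (key v₀ hv₀ 1 0 + key v₀ hv₀ (-1) 0 - 2 * key v₀ hv₀ 0 0) / 2
  have H_tu : 2 * dT (dU H) x - dT (dT T) x = 0 := by
    linear_combination (key v₀ hv₀ 1 0 - key v₀ hv₀ (-1) 0) / 2
  -- The coefficient of `u_rr`, multiplied by `v`.
  have kq : ∀ v ∈ V, v ≠ 0 → 0 + (2 * c * (dR Ξ x - dT T x)) * v
      + (-((a + b) * p * dR H x)) * v ^ p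
      + ((a + b) * (2 * (dR Ξ x - dT T x) - p * (dU H x - dR Ξ x))) * (v * v ^ p) = 0 := by
    intro v hv _
    linear_combination v * (key v hv 0 1 - key v hv 0 0)
      + ((a + b) * p * (dR H x + v * (dU H x - dR Ξ x))) * mul_rpow_sub_one (v := v) hp
  obtain ⟨-, q3, q12, qp⟩ := coeffs_of_combination_eq_zero hV ⟨v₀, hv₀⟩ hVp hp hp1 kq
  obtain ⟨l0, l3, -, -⟩ := coeffs_of_combination_eq_zero (p := p) hV ⟨v₀, hv₀⟩ hVp hp hp1
    (a₀ := dT (dT H) x - c * dR (dR H) x - (n - 1) / x.2.1 * c * dR H x)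
    (a₁ := (n - 1) / x.2.1 * c * (dU H x - 2 * dT T x) - 2 * c * dR (dU H) x + c * dR (dR Ξ) x
      - (n - 1) / x.2.1 * c * (dU H x - dR Ξ x) + (n - 1) / x.2.1 * c * (Ξ x / x.2.1))
    (a₂ := -((a + b) * dR (dR H) x) - (n - 1) / x.2.1 * b * (p + 1) * dR H x)
    (a₃ := (n - 1) / x.2.1 * b * (dU H x - 2 * dT T x - (p + 1) * (dU H x - dR Ξ x) + Ξ x / x.2.1)
      - 2 * (a + b) * dR (dU H) x + (a + b) * dR (dR Ξ) x)
    (fun v hv _ => by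
      linear_combination key v hv 0 0 + (c + (a + b) * v ^ p) * v ^ 2 * H_uu)
  refine ⟨H_uu, by linear_combination H_tu, ?_, fun h1 => ⟨?_, ?_⟩, fun h1 => ?_, ?_, l3⟩
  · linear_combination -((mul_eq_zero.1 q3).resolve_left hab)
  · linear_combination (q12 h1).1 / 2
  · refine (mul_eq_zero.1 (?_ : ((a + b) * p) * _ = 0)).resolve_left (mul_ne_zero hab hp)
    linear_combination -(q12 h1).2
  · have := qp h1
    rw [h1] at this
    linear_combination -this
  · linear_combination l0

end Determining

section Linear

variable {U : Set (ℝ × ℝ × ℝ)} {F G : ℝ × ℝ × ℝ → ℝ} {x : ℝ × ℝ × ℝ}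

theorem pd_add_smul (hF : DifferentiableAt ℝ F x) (hG : DifferentiableAt ℝ G x) (k l : ℝ)
    (e : ℝ × ℝ × ℝ) : pd e (fun y => k * F y + l * G y) x = k * pd e F x + l * pd e G x := by
  have h : HasFDerivAt (fun y => k * F y + l * G y) (k • fderiv ℝ F x + l • fderiv ℝ G x) x :=
    (hF.hasFDerivAt.const_mul k).add (hG.hasFDerivAt.const_mul l)
  simp [pd, h.fderiv]

end Linear

section Determining

variable {n a b c p : ℝ} {U : Set (ℝ × ℝ × ℝ)} {V : Set ℝ} {T Ξ H : ℝ × ℝ × ℝ → ℝ}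

/-- Every point symmetry solves the determining system. For `p = 1`, `c ≠ 0`, splitting in `u_r`
leaves `H_r` proportional to `Ξ_r - T_t`; that it vanishes only follows from the compatibility of
`H_tt = c (n-1) H_r / r` with the other equations. -/
theorem isDetSolution_of_prolong_eq_zero (hn : n ≠ 1) (hab : a + b ≠ 0) (hp : p ≠ 0)
    (hp1 : p ≠ -1) (hU : IsOpen U) (hUr : ∀ x ∈ U, 0 < x.2.1) (hV : IsOpen V) (hVn : V.Nonempty)
    (hVp : V ⊆ powDomain p) (hT : ContDiffOn ℝ (⊤ : ℕ∞) T U)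
    (hΞ : ContDiffOn ℝ (⊤ : ℕ∞) Ξ U) (hH : ContDiffOn ℝ (⊤ : ℕ∞) H U)
    (h : ∀ x ∈ U, ∀ v ∈ V, ∀ w s q, prolong T Ξ H x w v s q (c + (a + b) * v ^ p)
        ((a + b) * (p * v ^ (p - 1))) ((n - 1) * (c * v + b * v ^ (p + 1)))
        ((n - 1) * (c + b * ((p + 1) * v ^ p))) = 0) :
    IsDetSolution n a b c p U T Ξ H := by
  have h1 := fun x hx => first_order_of_prolong_eq_zero (F := fun v =>
    (n - 1) * (c * v + b * v ^ (p + 1))) (F' := fun v => (n - 1) * (c + b * ((p + 1) * v ^ p)))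
    hab hp hp1 hV hVn hVp (h x hx)
  have T_r := fun x hx => (h1 x hx).1
  have T_u := fun x hx => (h1 x hx).2.1
  have Ξ_t := fun x hx => (h1 x hx).2.2.1
  have Ξ_u := fun x hx => (h1 x hx).2.2.2
  have h2 := fun x hx => second_order_of_prolong_eq_zero hp hp1 hab hV hVn hVp (h x hx)
    (T_r x hx) (T_u x hx) (Ξ_t x hx) (Ξ_u x hx) (pd_eq_zero hU T_r hx _) (pd_eq_zero hU T_u hx _)
    (pd_eq_zero hU T_u hx _) (pd_eq_zero hU T_u hx _) (pd_eq_zero hU Ξ_t hx _)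
    (pd_eq_zero hU Ξ_u hx _) (pd_eq_zero hU Ξ_u hx _) (pd_eq_zero hU Ξ_u hx _)
  have dif {F : ℝ × ℝ × ℝ → ℝ} (hF : ContDiffOn ℝ (⊤ : ℕ∞) F U) (x) (hx : x ∈ U) :
      DifferentiableAt ℝ F x := differentiableAt_of_contDiffOn hU hF hx
  have H_r : ∀ x ∈ U, dR H x = 0 := by
    by_cases hp' : p = 1
    · subst hp'
      have hT' := contDiffOn_pd hU hT (1, 0, 0)
      have hΞ' := contDiffOn_pd hU hΞ (0, 1, 0)
      have T_tr : ∀ x ∈ U, dR (dT T) x = 0 := fun x hx =>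
        (pd_comm hU hT hx _ _).trans (pd_eq_zero hU T_r hx _)
      have T_tu : ∀ x ∈ U, dU (dT T) x = 0 := fun x hx =>
        (pd_comm hU hT hx _ _).trans (pd_eq_zero hU T_u hx _)
      have Ξ_rt : ∀ x ∈ U, dT (dR Ξ) x = 0 := fun x hx =>
        (pd_comm hU hΞ hx _ _).trans (pd_eq_zero hU Ξ_t hx _)
      have Ξ_ru : ∀ x ∈ U, dU (dR Ξ) x = 0 := fun x hx =>
        (pd_comm hU hΞ hx _ _).trans (pd_eq_zero hU Ξ_u hx _)
      have Hu : Set.EqOn (dU H) (fun y => 3 * dR Ξ y + (-2) * dT T y) U := fun x hx => by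
        linear_combination (h2 x hx).2.2.1
      have Hr : Set.EqOn (dR H)
          (fun y => (2 * c / (a + b)) * dR Ξ y + (-(2 * c / (a + b))) * dT T y) U := fun x hx => by
        have := (h2 x hx).2.2.2.2.1 rfl
        field_simp
        linear_combination this
      have lin {W : ℝ × ℝ × ℝ → ℝ} {k l : ℝ}
          (hW : Set.EqOn W (fun y => k * dR Ξ y + l * dT T y) U) (e x) (hx : x ∈ U) :
          pd e W x = k * pd e (dR Ξ) x + l * pd e (dT T) x :=
        (pd_congr hU hW hx e).trans (pd_add_smul (dif hΞ' x hx) (dif hT' x hx) k l e)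
      have H_ru : ∀ x ∈ U, dU (dR H) x = 0 := fun x hx => by
        linear_combination lin Hr (0, 0, 1) x hx + 2 * c / (a + b) * (Ξ_ru x hx - T_tu x hx)
      have H_ur : ∀ x ∈ U, dR (dU H) x = 0 := fun x hx =>
        (pd_comm hU hH hx _ _).trans (H_ru x hx)
      have Ξ_rr : ∀ x ∈ U, dR (dR Ξ) x = 0 := fun x hx => by
        linear_combination (H_ur x hx - lin Hu (0, 1, 0) x hx) / 3 + 2 / 3 * T_tr x hx
      have H_rr : ∀ x ∈ U, dR (dR H) x = 0 := fun x hx => by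
        linear_combination lin Hr (0, 1, 0) x hx + 2 * c / (a + b) * (Ξ_rr x hx - T_tr x hx)
      have T_tt : ∀ x ∈ U, dT (dT T) x = 0 := fun x hx => by
        linear_combination (2 * lin Hu (1, 0, 0) x hx - (h2 x hx).2.1 + 6 * Ξ_rt x hx) / 5
      have H_rt : ∀ x ∈ U, dT (dR H) x = 0 := fun x hx => by
        linear_combination lin Hr (1, 0, 0) x hx + 2 * c / (a + b) * (Ξ_rt x hx - T_tt x hx)
      -- The left side of `r H_tt = (n-1) c H_r` is `r` times a function independent of `r`, the
      -- right side is independent of `r`; hence both vanish.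
      have H_ttr : ∀ x ∈ U, dR (dT (dT H)) x = 0 := fun x hx => by
        rw [dR, pd_comm hU (contDiffOn_pd hU hH _) hx]
        refine pd_eq_zero hU (fun y hy => ?_) hx _
        exact (pd_comm hU hH hy _ _).trans (H_rt y hy)
      have H_tt : Set.EqOn (dT (dT H)) (fun x => (n - 1) * c * dR H x * x.2.1⁻¹) U := fun x hx => by
        have h3 := (h2 x hx).2.2.2.2.2.1
        rw [H_rr x hx] at h3
        linear_combination h3
      intro x hx
      by_cases hc : c = 0
      · rw [Hr hx, hc]; ring
      have hr := (hUr x hx).ne'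
      have hd : DifferentiableAt ℝ (fun x => (n - 1) * c * dR H x * x.2.1⁻¹) x :=
        ((dif (contDiffOn_pd hU hH (0, 1, 0)) x hx).const_mul _).mul
          ((by fun_prop : DifferentiableAt ℝ (fun x : ℝ × ℝ × ℝ => x.2.1) x).inv hr)
      have hd' := dR_eq_of_hasDerivAt hd
        (((hasDerivAt_slice_r (dif (contDiffOn_pd hU hH (0, 1, 0)) x hx)).const_mul
          ((n - 1) * c)).mul (hasDerivAt_inv hr))
      have e := H_ttr x hx
      rw [dR, pd_congr hU H_tt hx] at e
      rw [dR] at hd'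
      rw [hd', H_rr x hx] at e
      have hk : (n - 1) * c ≠ 0 := mul_ne_zero (sub_ne_zero.2 hn) hc
      field_simp at e
      simpa [hk, sub_ne_zero.2 hn, hc] using e
    · exact fun x hx => ((h2 x hx).2.2.2.1 hp').2
  have c_eq : ∀ x ∈ U, c * (dR Ξ x - dT T x) = 0 := fun x hx => by
    by_cases hp' : p = 1
    · linear_combination -((h2 x hx).2.2.2.2.1 hp') / 2 + (a + b) / 2 * H_r x hx
    · exact ((h2 x hx).2.2.2.1 hp').1
  refine ⟨T_r, T_u, Ξ_t, Ξ_u, H_r, fun x hx => (h2 x hx).1, fun x hx => ?_, fun x hx => (h2 x hx).2.1,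
    fun x hx => (h2 x hx).2.2.1, c_eq, fun x hx => ?_⟩
  · have H_rr : dR (dR H) x = 0 := pd_eq_zero hU H_r hx _
    rw [(h2 x hx).2.2.2.2.2.1, H_rr, H_r x hx]
    ring
  · have H_ru : dR (dU H) x = 0 := (pd_comm hU hH hx _ _).trans (pd_eq_zero hU H_r hx _)
    have h3 := (h2 x hx).2.2.2.2.2.2
    have h4 := (h2 x hx).2.2.1
    have hr := (hUr x hx).ne'
    rw [H_ru] at h3
    field_simp at h3
    linear_combination h3 + b * (n - 1) * x.2.1 * h4

end Determining

/-! ### Integration of the determining system -/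

section Integration

variable {n a b c p : ℝ} {U : Set (ℝ × ℝ × ℝ)} {T Ξ H : ℝ × ℝ × ℝ → ℝ}

/-- Two functions with the same gradient on a connected open set differ by a constant. -/
theorem exists_eq_add_const (hU : IsOpen U) (hUc : IsConnected U) {F G : ℝ × ℝ × ℝ → ℝ}
    (hF : ContDiffOn ℝ (⊤ : ℕ∞) F U) (hG : ∀ x ∈ U, DifferentiableAt ℝ G x)
    (ht : ∀ x ∈ U, HasDerivAt (fun s => G (s, x.2.1, x.2.2)) (dT F x) x.1)
    (hr : ∀ x ∈ U, HasDerivAt (fun s => G (x.1, s, x.2.2)) (dR F x) x.2.1)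
    (hu : ∀ x ∈ U, HasDerivAt (fun s => G (x.1, x.2.1, s)) (dU F x) x.2.2) :
    ∃ k, ∀ x ∈ U, F x = G x + k := by
  have hF' := fun x hx => differentiableAt_of_contDiffOn (x := x) hU hF hx
  have key : ∀ x ∈ U, ∀ e, pd e F x = pd e G x → pd e (fun y => 1 * F y + (-1) * G y) x = 0 :=
    fun x hx e h => by rw [pd_add_smul (hF' x hx) (hG x hx), h]; ring
  obtain ⟨k, hk⟩ := exists_const_of_pd_eq_zero (F := fun y => 1 * F y + (-1) * G y) hU hUc
    (fun x hx => (((hF' x hx).const_mul 1).add ((hG x hx).const_mul (-1))).differentiableWithinAt)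
    (fun x hx => key x hx _ (dT_eq_of_hasDerivAt (hG x hx) (ht x hx)).symm)
    (fun x hx => key x hx _ (dR_eq_of_hasDerivAt (hG x hx) (hr x hx)).symm)
    (fun x hx => key x hx _ (dU_eq_of_hasDerivAt (hG x hx) (hu x hx)).symm)
  exact ⟨k, fun x hx => by linear_combination hk x hx⟩

/-- Integration of the determining system in `t` and `u`. -/
theorem IsDetSolution.exists_T_H (hU : IsOpen U) (hUc : IsConnected U)
    (hT : ContDiffOn ℝ (⊤ : ℕ∞) T U) (hH : ContDiffOn ℝ (⊤ : ℕ∞) H U)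
    (h : IsDetSolution n a b c p U T Ξ H) :
    ∃ α β θ γ δ e : ℝ, ∀ x ∈ U, T x = β + α * x.1 + θ * x.1 ^ 2 ∧
      H x = (e + θ * x.1) * x.2.2 + γ * x.1 + δ ∧
      dT T x = α + 2 * θ * x.1 ∧ dU H x = e + θ * x.1 ∧ dT (dT T) x = 2 * θ := by
  have hTt : ContDiffOn ℝ (⊤ : ℕ∞) (dT T) U := contDiffOn_pd hU hT _
  have hTtt : ContDiffOn ℝ (⊤ : ℕ∞) (dT (dT T)) U := contDiffOn_pd hU hTt _
  have hHt : ContDiffOn ℝ (⊤ : ℕ∞) (dT H) U := contDiffOn_pd hU hH _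
  have hHu : ContDiffOn ℝ (⊤ : ℕ∞) (dU H) U := contDiffOn_pd hU hH _
  have T_tr : ∀ x ∈ U, dR (dT T) x = 0 := fun x hx =>
    (pd_comm hU hT hx _ _).trans (pd_eq_zero hU h.T_r hx _)
  have T_tu : ∀ x ∈ U, dU (dT T) x = 0 := fun x hx =>
    (pd_comm hU hT hx _ _).trans (pd_eq_zero hU h.T_u hx _)
  have H_ru : ∀ x ∈ U, dR (dU H) x = 0 := fun x hx =>
    (pd_comm hU hH hx _ _).trans (pd_eq_zero hU h.H_r hx _)
  have H_rt : ∀ x ∈ U, dR (dT H) x = 0 := fun x hx =>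
    (pd_comm hU hH hx _ _).trans (pd_eq_zero hU h.H_r hx _)
  -- `T_ttt = 2 H_ttu`, and `H_tt = 0`.
  have T_ttt : ∀ x ∈ U, dT (dT (dT T)) x = 0 := fun x hx => by
    have e1 : dT (dT (dU H)) x = 0 := by
      have : Set.EqOn (dT (dU H)) (dU (dT H)) U := fun y hy => pd_comm hU hH hy _ _
      rw [dT, pd_congr hU this hx, pd_comm hU hHt hx]
      exact pd_eq_zero hU h.H_tt hx _
    have e2 : Set.EqOn (dT (dT T)) (fun y => 1 * dT (dU H) y + 1 * dT (dU H) y) U :=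
      fun y hy => by linear_combination -h.H_tu y hy
    have hd := differentiableAt_of_contDiffOn hU (contDiffOn_pd hU hHu (1, 0, 0)) hx
    linear_combination pd_congr hU e2 hx (1, 0, 0) + pd_add_smul hd hd 1 1 (1, 0, 0) + 2 * e1
  obtain ⟨θ', hθ⟩ := exists_const_of_pd_eq_zero hU hUc
    (fun x hx => (differentiableAt_of_contDiffOn hU hTtt hx).differentiableWithinAt) T_ttt
    (fun x hx => (pd_comm hU hTt hx _ _).trans (pd_eq_zero hU T_tr hx _))
    (fun x hx => (pd_comm hU hTt hx _ _).trans (pd_eq_zero hU T_tu hx _))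
  obtain ⟨θ, rfl⟩ : ∃ θ, θ' = 2 * θ := ⟨θ' / 2, by ring⟩
  obtain ⟨α, hα⟩ := exists_eq_add_const hU hUc hTt (G := fun x => 2 * θ * x.1)
    (fun x _ => by fun_prop)
    (fun x hx => by rw [hθ x hx]; simpa using (hasDerivAt_id x.1).const_mul (2 * θ))
    (fun x hx => by rw [T_tr x hx]; dsimp only; exact hasDerivAt_const _ _)
    (fun x hx => by rw [T_tu x hx]; dsimp only; exact hasDerivAt_const _ _)
  obtain ⟨β, hβ⟩ := exists_eq_add_const hU hUc hT (G := fun x => α * x.1 + θ * x.1 ^ 2)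
    (fun x _ => by fun_prop)
    (fun x hx => by
      rw [hα x hx]
      refine (((hasDerivAt_id x.1).const_mul α).add
        ((hasDerivAt_pow 2 x.1).const_mul θ)).congr_deriv ?_
      simp; ring)
    (fun x hx => by rw [h.T_r x hx]; dsimp only; exact hasDerivAt_const _ _)
    (fun x hx => by rw [h.T_u x hx]; dsimp only; exact hasDerivAt_const _ _)
  have H_tu : ∀ x ∈ U, dT (dU H) x = θ := fun x hx => by
    linear_combination (h.H_tu x hx + hθ x hx) / 2
  obtain ⟨e, he⟩ := exists_eq_add_const hU hUc hHu (G := fun x => θ * x.1)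
    (fun x _ => by fun_prop)
    (fun x hx => by rw [H_tu x hx]; simpa using (hasDerivAt_id x.1).const_mul θ)
    (fun x hx => by rw [H_ru x hx]; dsimp only; exact hasDerivAt_const _ _)
    (fun x hx => by rw [h.H_uu x hx]; dsimp only; exact hasDerivAt_const _ _)
  obtain ⟨γ, hγ⟩ := exists_eq_add_const hU hUc hHt (G := fun x => θ * x.2.2)
    (fun x _ => by fun_prop)
    (fun x hx => by rw [h.H_tt x hx]; dsimp only; exact hasDerivAt_const _ _)
    (fun x hx => by rw [H_rt x hx]; dsimp only; exact hasDerivAt_const _ _)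
    (fun x hx => by
      rw [dU, pd_comm hU hH hx, show pd (1, 0, 0) (pd (0, 0, 1) H) x = θ from H_tu x hx]
      simpa using (hasDerivAt_id x.2.2).const_mul θ)
  obtain ⟨δ, hδ⟩ := exists_eq_add_const hU hUc hH
    (G := fun x => (e + θ * x.1) * x.2.2 + γ * x.1)
    (fun x _ => by fun_prop)
    (fun x hx => by
      rw [hγ x hx]
      refine (((((hasDerivAt_id x.1).const_mul θ).const_add e).mul_const x.2.2).add
        ((hasDerivAt_id x.1).const_mul γ)).congr_deriv ?_
      ring)
    (fun x hx => by rw [h.H_r x hx]; dsimp only; exact hasDerivAt_const _ _)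
    (fun x hx => by
      rw [he x hx]
      refine (((hasDerivAt_id x.2.2).const_mul (e + θ * x.1)).add_const (γ * x.1)).congr_deriv ?_
      ring)
  exact ⟨α, β, θ, γ, δ, e, fun x hx => ⟨by linear_combination hβ x hx,
    by linear_combination hδ x hx, by linear_combination hα x hx, by linear_combination he x hx,
    hθ x hx⟩⟩

/-- The compatibility condition that restricts `T` to be affine in `t` unless `p = -4`. -/
theorem IsDetSolution.T_tt (hU : IsOpen U) (hT : ContDiffOn ℝ (⊤ : ℕ∞) T U)
    (hΞ : ContDiffOn ℝ (⊤ : ℕ∞) Ξ U) (hH : ContDiffOn ℝ (⊤ : ℕ∞) H U)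
    (h : IsDetSolution n a b c p U T Ξ H) {x : ℝ × ℝ × ℝ} (hx : x ∈ U) :
    (p + 4) * dT (dT T) x = 0 ∧ c * dT (dT T) x = 0 := by
  have dif {F : ℝ × ℝ × ℝ → ℝ} (hF : ContDiffOn ℝ (⊤ : ℕ∞) F U) (e : ℝ × ℝ × ℝ) :
      DifferentiableAt ℝ (pd e F) x := differentiableAt_of_contDiffOn hU (contDiffOn_pd hU hF e) hx
  have Ξ_rt : dT (dR Ξ) x = 0 := (pd_comm hU hΞ hx _ _).trans (pd_eq_zero hU h.Ξ_t hx _)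
  constructor
  · have e1 : Set.EqOn (fun y => p * dU H y + 2 * dT T y) (fun y => (p + 2) * dR Ξ y + 0 * dR Ξ y)
        U := fun y hy => by linear_combination h.H_u y hy
    have e2 := pd_congr hU e1 hx (1, 0, 0)
    rw [pd_add_smul (dif hH _) (dif hT _), pd_add_smul (dif hΞ _) (dif hΞ _)] at e2
    linear_combination 2 * e2 - p * h.H_tu x hx + 2 * (p + 2) * Ξ_rt
  · have e1 : Set.EqOn (fun y => c * dR Ξ y + (-c) * dT T y) (fun y => 0) U :=
      fun y hy => by linear_combination h.c_eq y hy
    have e2 := pd_congr hU e1 hx (1, 0, 0)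
    rw [pd_add_smul (dif hΞ _) (dif hT _), pd_const] at e2
    linear_combination c * Ξ_rt - e2

/-- The compatibility condition that makes `Ξ` linear in `r` unless `p = -2` and `c = 0`. -/
theorem IsDetSolution.Ξ_rr_eq_zero (hU : IsOpen U) (hT : ContDiffOn ℝ (⊤ : ℕ∞) T U)
    (hΞ : ContDiffOn ℝ (⊤ : ℕ∞) Ξ U) (hH : ContDiffOn ℝ (⊤ : ℕ∞) H U)
    (h : IsDetSolution n a b c p U T Ξ H) {x : ℝ × ℝ × ℝ} (hx : x ∈ U) :
    (p + 2) * dR (dR Ξ) x = 0 ∧ c * dR (dR Ξ) x = 0 := by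
  have dif {F : ℝ × ℝ × ℝ → ℝ} (hF : ContDiffOn ℝ (⊤ : ℕ∞) F U) (e : ℝ × ℝ × ℝ) :
      DifferentiableAt ℝ (pd e F) x := differentiableAt_of_contDiffOn hU (contDiffOn_pd hU hF e) hx
  have T_tr : dR (dT T) x = 0 := (pd_comm hU hT hx _ _).trans (pd_eq_zero hU h.T_r hx _)
  have H_ru : dR (dU H) x = 0 := (pd_comm hU hH hx _ _).trans (pd_eq_zero hU h.H_r hx _)
  constructor
  · have e1 : Set.EqOn (fun y => p * dU H y + 2 * dT T y) (fun y => (p + 2) * dR Ξ y + 0 * dR Ξ y)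
        U := fun y hy => by linear_combination h.H_u y hy
    have e2 := pd_congr hU e1 hx (0, 1, 0)
    rw [pd_add_smul (dif hH _) (dif hT _), pd_add_smul (dif hΞ _) (dif hΞ _)] at e2
    linear_combination -e2 + p * H_ru + 2 * T_tr
  · have e1 : Set.EqOn (fun y => c * dR Ξ y + (-c) * dT T y) (fun y => 0) U :=
      fun y hy => by linear_combination h.c_eq y hy
    have e2 := pd_congr hU e1 hx (0, 1, 0)
    rw [pd_add_smul (dif hΞ _) (dif hT _), pd_const] at e2
    linear_combination e2 + c * T_tr

/-- If `Ξ_rr = 0`, the Euler equation, whose right-hand side has the nonzero factor `b (n-1)`,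
forces `Ξ = r Ξ_r`. -/
theorem IsDetSolution.exists_Ξ_linear (hn : n ≠ 1) (hb : b ≠ 0) (hU : IsOpen U)
    (hUc : IsConnected U) (hΞ : ContDiffOn ℝ (⊤ : ℕ∞) Ξ U)
    (h : IsDetSolution n a b c p U T Ξ H) (hrr : ∀ x ∈ U, dR (dR Ξ) x = 0) :
    ∃ κ : ℝ, ∀ x ∈ U, Ξ x = κ * x.2.1 ∧ dR Ξ x = κ := by
  obtain ⟨κ, hκ⟩ := exists_const_of_pd_eq_zero hU hUc
    (fun x hx => (differentiableAt_of_contDiffOn hU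
      (contDiffOn_pd hU hΞ (0, 1, 0)) hx).differentiableWithinAt)
    (fun x hx => (pd_comm hU hΞ hx _ _).trans (pd_eq_zero hU h.Ξ_t hx _)) hrr
    (fun x hx => (pd_comm hU hΞ hx _ _).trans (pd_eq_zero hU h.Ξ_u hx _))
  refine ⟨κ, fun x hx => ⟨?_, hκ x hx⟩⟩
  have hk : b * (n - 1) ≠ 0 := mul_ne_zero hb (sub_ne_zero.2 hn)
  have e := h.Ξ_rr x hx
  rw [hrr x hx, show dR Ξ x = κ from hκ x hx, mul_zero] at e
  have := (mul_eq_zero.1 e.symm).resolve_left hk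
  linear_combination -this

/-- The Euler equation `r² Ξ'' = -m (r Ξ' - Ξ)` is integrated in two steps: `r Ξ' - Ξ = C r^{-m}`,
and then `Ξ / r` is found from `(Ξ / r)' = C r^{-m-2}`; `L` is any primitive of `r^{-m-2}`. -/
theorem IsDetSolution.exists_Ξ_euler (hU : IsOpen U) (hUc : IsConnected U)
    (hUr : ∀ x ∈ U, 0 < x.2.1) (hab : a + b ≠ 0)
    (hΞ : ContDiffOn ℝ (⊤ : ℕ∞) Ξ U) (h : IsDetSolution n a b c p U T Ξ H) {m : ℝ}
    (hm : m = -(b * (n - 1)) / (a + b)) {L : ℝ → ℝ}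
    (hL : ∀ r, 0 < r → HasDerivAt L (r ^ (-m - 2)) r) :
    ∃ C D : ℝ, ∀ x ∈ U, Ξ x = D * x.2.1 + C * (x.2.1 * L x.2.1) := by
  have hΞr := contDiffOn_pd hU hΞ (0, 1, 0)
  have hd := fun x hx => differentiableAt_of_contDiffOn (x := x) hU hΞ hx
  have hdr := fun x hx => differentiableAt_of_contDiffOn (x := x) hU hΞr hx
  have Ξ_rt : ∀ x ∈ U, dT (dR Ξ) x = 0 := fun x hx =>
    (pd_comm hU hΞ hx _ _).trans (pd_eq_zero hU h.Ξ_t hx _)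
  have Ξ_ru : ∀ x ∈ U, dU (dR Ξ) x = 0 := fun x hx =>
    (pd_comm hU hΞ hx _ _).trans (pd_eq_zero hU h.Ξ_u hx _)
  have hfr : ∀ x : ℝ × ℝ × ℝ, DifferentiableAt ℝ (fun x : ℝ × ℝ × ℝ => x.2.1) x :=
    fun x => by fun_prop
  have hy : ∀ x ∈ U, DifferentiableAt ℝ
      (fun x => (x.2.1 * dR Ξ x - Ξ x) * x.2.1 ^ m) x := fun x hx =>
    (((hfr x).mul (hdr x hx)).sub (hd x hx)).mul ((hfr x).rpow_const (Or.inl (hUr x hx).ne'))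
  have heul : ∀ x ∈ U, x.2.1 ^ 2 * dR (dR Ξ) x = -m * (x.2.1 * dR Ξ x - Ξ x) := fun x hx => by
    refine mul_left_cancel₀ hab ?_
    rw [hm]
    field_simp
    linear_combination h.Ξ_rr x hx
  obtain ⟨C, hC⟩ := exists_const_of_pd_eq_zero hU hUc
    (fun x hx => (hy x hx).differentiableWithinAt)
    (fun x hx => (dT_eq_of_hasDerivAt (hy x hx) ((((hasDerivAt_slice_t (hdr x hx)).const_mul
      x.2.1).sub (hasDerivAt_slice_t (hd x hx))).mul_const (x.2.1 ^ m))).trans (by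
        rw [Ξ_rt x hx, h.Ξ_t x hx]; ring))
    (fun x hx => (dR_eq_of_hasDerivAt (hy x hx) ((((hasDerivAt_id x.2.1).mul
      (hasDerivAt_slice_r (hdr x hx))).sub (hasDerivAt_slice_r (hd x hx))).mul
      (Real.hasDerivAt_rpow_const (p := m) (Or.inl (hUr x hx).ne')))).trans (by
        have hr := (hUr x hx).ne'
        simp only [id, Prod.mk.eta, Pi.mul_apply, Pi.sub_apply]
        rw [Real.rpow_sub_one hr]
        field_simp
        linear_combination x.2.1 ^ m * heul x hx))
    (fun x hx => (dU_eq_of_hasDerivAt (hy x hx) ((((hasDerivAt_slice_u (hdr x hx)).const_mul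
      x.2.1).sub (hasDerivAt_slice_u (hd x hx))).mul_const (x.2.1 ^ m))).trans (by
        rw [Ξ_ru x hx, h.Ξ_u x hx]; ring))
  have hq : ∀ x ∈ U, DifferentiableAt ℝ (fun x => Ξ x * x.2.1⁻¹) x := fun x hx =>
    (hd x hx).mul ((hfr x).inv (hUr x hx).ne')
  have hqs : ContDiffOn ℝ (⊤ : ℕ∞) (fun x => Ξ x * x.2.1⁻¹) U :=
    hΞ.mul (ContDiffOn.inv (by fun_prop) fun x hx => (hUr x hx).ne')
  obtain ⟨D, hD⟩ := exists_eq_add_const hU hUc hqs (G := fun x => C * L x.2.1)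
    (fun x hx => ((hL _ (hUr x hx)).differentiableAt.comp x (hfr x)).const_mul C)
    (fun x hx => by
      rw [dT_eq_of_hasDerivAt (hq x hx) ((hasDerivAt_slice_t (hd x hx)).mul_const x.2.1⁻¹),
        h.Ξ_t x hx, zero_mul]
      exact hasDerivAt_const _ (C * L x.2.1))
    (fun x hx => by
      have hr := (hUr x hx).ne'
      rw [dR_eq_of_hasDerivAt (hq x hx) ((hasDerivAt_slice_r (hd x hx)).mul (hasDerivAt_inv hr))]
      refine ((hL _ (hUr x hx)).const_mul C).congr_deriv ?_
      rw [← hC x hx, show -m - 2 = -(m + 2) by ring, Real.rpow_neg (hUr x hx).le,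
        Real.rpow_add (hUr x hx), Real.rpow_two]
      have := (Real.rpow_pos_of_pos (hUr x hx) m).ne'
      field_simp
      ring)
    (fun x hx => by
      rw [dU_eq_of_hasDerivAt (hq x hx) ((hasDerivAt_slice_u (hd x hx)).mul_const x.2.1⁻¹),
        h.Ξ_u x hx, zero_mul]
      exact hasDerivAt_const _ (C * L x.2.1))
  refine ⟨C, D, fun x hx => ?_⟩
  have := hD x hx
  have hr := (hUr x hx).ne'
  field_simp at this
  linear_combination this

end Integration

/-! ### Explicit solutions of the determining system -/

section Sufficiency

variable {n a b c p : ℝ} {U : Set (ℝ × ℝ × ℝ)} {V : Set ℝ}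

/-- Point symmetries are the smooth solutions of the determining system. -/
theorem isPointSymmetry_iff_isDetSolution (hn : n ≠ 1) (hb : b ≠ 0) (hab : a + b ≠ 0)
    (hp : p ≠ 0) (hp1 : p ≠ -1) (hU : IsOpen U) (hUr : ∀ x ∈ U, 0 < x.2.1) (hV : IsOpen V)
    (hVn : V.Nonempty) (hVp : V ⊆ powDomain p) {T Ξ H : ℝ × ℝ × ℝ → ℝ} :
    IsPointSymmetry (gB a b c p) (fB n b c p) U V (fun x => (T x, Ξ x, H x)) ↔
      (ContDiffOn ℝ (⊤ : ℕ∞) T U ∧ ContDiffOn ℝ (⊤ : ℕ∞) Ξ U ∧ ContDiffOn ℝ (⊤ : ℕ∞) H U) ∧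
        IsDetSolution n a b c p U T Ξ H := by
  rw [isPointSymmetry_gB_fB_iff hp hU hUr hVp]
  refine and_congr_right fun ⟨hT, hΞ, hH⟩ => ⟨fun h => ?_, fun h x hx v _ w s q => ?_⟩
  · exact isDetSolution_of_prolong_eq_zero hn hab hp hp1 hU hUr hV hVn hVp hT hΞ hH h
  · exact h.prolong_eq_zero hn hb hp hp1 hU hUr hT hH hx w v s q

/-- The vector fields that occur in the classification, with the conditions under which they solve
the determining system. -/
theorem isDetSolution_of_explicit (hU : IsOpen U) (hUr : ∀ x ∈ U, 0 < x.2.1)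
    (α β θ γ δ e : ℝ) {ξ ξ' ξ'' : ℝ → ℝ}
    (h0 : ∀ r, 0 < r → HasDerivAt ξ (ξ' r) r) (h1 : ∀ r, 0 < r → HasDerivAt ξ' (ξ'' r) r)
    (hu : ∀ x ∈ U, p * (e + θ * x.1 - ξ' x.2.1) = 2 * (ξ' x.2.1 - (α + 2 * θ * x.1)))
    (hc : ∀ x ∈ U, c * (ξ' x.2.1 - (α + 2 * θ * x.1)) = 0)
    (hr : ∀ r, 0 < r → (a + b) * r ^ 2 * ξ'' r = b * (n - 1) * (r * ξ' r - ξ r)) :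
    IsDetSolution n a b c p U (fun x => β + α * x.1 + θ * x.1 ^ 2) (fun x => ξ x.2.1)
      (fun x => (e + θ * x.1) * x.2.2 + γ * x.1 + δ) := by
  have hΞd : ∀ x ∈ U, DifferentiableAt ℝ (fun x : ℝ × ℝ × ℝ => ξ x.2.1) x := fun x hx =>
    (h0 _ (hUr x hx)).differentiableAt.comp x (by fun_prop)
  have hΞd' : ∀ x ∈ U, DifferentiableAt ℝ (fun x : ℝ × ℝ × ℝ => ξ' x.2.1) x := fun x hx =>
    (h1 _ (hUr x hx)).differentiableAt.comp x (by fun_prop)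
  have T_t : dT (fun x : ℝ × ℝ × ℝ => β + α * x.1 + θ * x.1 ^ 2) =
      fun x => α + 2 * θ * x.1 := funext fun x => dT_eq_of_hasDerivAt (by fun_prop) <|
    ((((hasDerivAt_id x.1).const_mul α).const_add β).add
        ((hasDerivAt_pow 2 x.1).const_mul θ)).congr_deriv (by simp; ring)
  have T_tt : dT (fun x : ℝ × ℝ × ℝ => α + 2 * θ * x.1) = fun x => 2 * θ :=
    funext fun x => dT_eq_of_hasDerivAt (by fun_prop) <|
      (((hasDerivAt_id x.1).const_mul (2 * θ)).const_add α).congr_deriv (by ring)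
  have H_u : dU (fun x : ℝ × ℝ × ℝ => (e + θ * x.1) * x.2.2 + γ * x.1 + δ) =
      fun x => e + θ * x.1 := funext fun x => dU_eq_of_hasDerivAt (by fun_prop) <|
    ((((hasDerivAt_id x.2.2).const_mul (e + θ * x.1)).add_const (γ * x.1)).add_const
      δ).congr_deriv (by ring)
  have H_t : dT (fun x : ℝ × ℝ × ℝ => (e + θ * x.1) * x.2.2 + γ * x.1 + δ) =
      fun x => θ * x.2.2 + γ := funext fun x => dT_eq_of_hasDerivAt (by fun_prop) <|
    ((((((hasDerivAt_id x.1).const_mul θ).const_add e).mul_const x.2.2).add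
      ((hasDerivAt_id x.1).const_mul γ)).add_const δ).congr_deriv (by ring)
  have H_tu : dT (fun x : ℝ × ℝ × ℝ => e + θ * x.1) = fun x => θ :=
    funext fun x => dT_eq_of_hasDerivAt (by fun_prop) <|
      (((hasDerivAt_id x.1).const_mul θ).const_add e).congr_deriv (by ring)
  have Ξ_r : ∀ x ∈ U, dR (fun x : ℝ × ℝ × ℝ => ξ x.2.1) x = ξ' x.2.1 := fun x hx =>
    dR_eq_of_hasDerivAt (hΞd x hx) (h0 _ (hUr x hx))
  refine ⟨fun x _ => ?_, fun x _ => ?_, fun x hx => ?_, fun x hx => ?_, fun x _ => ?_,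
    fun x _ => ?_, fun x _ => ?_, fun x _ => ?_, fun x hx => ?_, fun x hx => ?_, fun x hx => ?_⟩
  · exact dR_eq_of_hasDerivAt (by fun_prop) (hasDerivAt_const x.2.1 (β + α * x.1 + θ * x.1 ^ 2))
  · exact dU_eq_of_hasDerivAt (by fun_prop) (hasDerivAt_const x.2.2 (β + α * x.1 + θ * x.1 ^ 2))
  · exact dT_eq_of_hasDerivAt (hΞd x hx) (hasDerivAt_const x.1 (ξ x.2.1))
  · exact dU_eq_of_hasDerivAt (hΞd x hx) (hasDerivAt_const x.2.2 (ξ x.2.1))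
  · exact dR_eq_of_hasDerivAt (by fun_prop)
      (hasDerivAt_const x.2.1 ((e + θ * x.1) * x.2.2 + γ * x.1 + δ))
  · rw [H_u]
    exact dU_eq_of_hasDerivAt (by fun_prop) (hasDerivAt_const x.2.2 (e + θ * x.1))
  · rw [H_t]
    exact dT_eq_of_hasDerivAt (by fun_prop) (hasDerivAt_const x.1 (θ * x.2.2 + γ))
  · rw [H_u, T_t, H_tu, T_tt]
  · rw [H_u, T_t, Ξ_r x hx]
    exact hu x hx
  · rw [T_t, Ξ_r x hx]
    exact hc x hx
  · have : dR (dR (fun x : ℝ × ℝ × ℝ => ξ x.2.1)) x = ξ'' x.2.1 :=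
      (pd_congr hU Ξ_r hx _).trans (dR_eq_of_hasDerivAt (hΞd' x hx) (h1 _ (hUr x hx)))
    rw [this, Ξ_r x hx]
    exact hr _ (hUr x hx)

end Sufficiency

/-! ### Linear independence and bases -/

section Independence

variable {U : Set (ℝ × ℝ × ℝ)}

/-- An open set contains a box; sampling at a few of its points is enough to show that
the coefficients of the explicit fields vanish. -/
theorem exists_box_subset (hU : IsOpen U) (hUn : U.Nonempty) : ∃ t r u ε : ℝ, 0 < ε ∧
    ∀ i j k : ℝ, |i| ≤ 1 → |j| ≤ 1 → |k| ≤ 1 → (t + ε * i, r + ε * j, u + ε * k) ∈ U := by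
  obtain ⟨x, hx⟩ := hUn
  obtain ⟨ε, hε, h⟩ := Metric.nhds_basis_closedBall.mem_iff.1 (hU.mem_nhds hx)
  have key : ∀ t i : ℝ, |i| ≤ 1 → dist (t + ε * i) t ≤ ε := fun t i hi => by
    rw [Real.dist_eq, add_sub_cancel_left, abs_mul, abs_of_pos hε]
    exact mul_le_of_le_one_right hε.le hi
  refine ⟨x.1, x.2.1, x.2.2, ε, hε, fun i j k hi hj hk => h ?_⟩
  rw [Metric.mem_closedBall, Prod.dist_eq, Prod.dist_eq]
  exact max_le (key _ _ hi) (max_le (key _ _ hj) (key _ _ hk))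

theorem coeffs_T_eq_zero (hU : IsOpen U) (hUn : U.Nonempty) {α β θ : ℝ}
    (h : ∀ x ∈ U, β + α * x.1 + θ * x.1 ^ 2 = 0) : β = 0 ∧ α = 0 ∧ θ = 0 := by
  obtain ⟨t, r, u, ε, hε, hbox⟩ := exists_box_subset hU hUn
  have e0 := h _ (hbox 0 0 0 (by norm_num) (by norm_num) (by norm_num))
  have e1 := h _ (hbox 1 0 0 (by norm_num) (by norm_num) (by norm_num))
  have e2 := h _ (hbox (-1) 0 0 (by norm_num) (by norm_num) (by norm_num))
  simp only at e0 e1 e2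
  have hθ : θ = 0 := by
    refine (mul_eq_zero.1 (?_ : ε ^ 2 * θ = 0)).resolve_left (by positivity)
    linear_combination (e1 + e2 - 2 * e0) / 2
  have hα : α = 0 := by
    refine (mul_eq_zero.1 (?_ : ε * α = 0)).resolve_left hε.ne'
    linear_combination (e1 - e2) / 2 - 2 * ε * t * hθ
  exact ⟨by linear_combination e0 - t * hα - t ^ 2 * hθ, hα, hθ⟩

theorem coeffs_H_eq_zero (hU : IsOpen U) (hUn : U.Nonempty) {θ γ δ e : ℝ}
    (h : ∀ x ∈ U, (e + θ * x.1) * x.2.2 + γ * x.1 + δ = 0) :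
    e = 0 ∧ θ = 0 ∧ γ = 0 ∧ δ = 0 := by
  obtain ⟨t, r, u, ε, hε, hbox⟩ := exists_box_subset hU hUn
  have e0 := h _ (hbox 0 0 0 (by norm_num) (by norm_num) (by norm_num))
  have e1 := h _ (hbox 1 0 0 (by norm_num) (by norm_num) (by norm_num))
  have e2 := h _ (hbox 0 0 1 (by norm_num) (by norm_num) (by norm_num))
  have e3 := h _ (hbox 1 0 1 (by norm_num) (by norm_num) (by norm_num))
  simp only at e0 e1 e2 e3
  have hθ : θ = 0 := by
    refine (mul_eq_zero.1 (?_ : ε ^ 2 * θ = 0)).resolve_left (by positivity)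
    linear_combination e3 - e2 - e1 + e0
  have he : e = 0 := by
    refine (mul_eq_zero.1 (?_ : ε * e = 0)).resolve_left hε.ne'
    linear_combination e2 - e0 - t * ε * hθ
  have hγ : γ = 0 := by
    refine (mul_eq_zero.1 (?_ : ε * γ = 0)).resolve_left hε.ne'
    linear_combination e1 - e0 - ε * u * hθ
  exact ⟨he, hθ, hγ, by linear_combination e0 - (t * u) * hθ - u * he - t * hγ⟩

/-- Independence of `r` and `r L(r)` for injective `L`, from two values of `r`. -/
theorem coeffs_Ξ_eq_zero (hU : IsOpen U) (hUn : U.Nonempty) (hUr : ∀ x ∈ U, 0 < x.2.1)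
    {L : ℝ → ℝ} (hL : Set.InjOn L (Set.Ioi 0)) {κ C : ℝ}
    (h : ∀ x ∈ U, κ * x.2.1 + C * (x.2.1 * L x.2.1) = 0) : κ = 0 ∧ C = 0 := by
  obtain ⟨t, r, u, ε, hε, hbox⟩ := exists_box_subset hU hUn
  have key : ∀ j, |j| ≤ 1 → 0 < r + ε * j ∧ κ + C * L (r + ε * j) = 0 := fun j hj => by
    have hm := hbox 0 j 0 (by norm_num) hj (by norm_num)
    refine ⟨hUr _ hm, (mul_eq_zero.1 (?_ : (r + ε * j) * _ = 0)).resolve_left (hUr _ hm).ne'⟩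
    linear_combination h _ hm
  obtain ⟨p0, k0⟩ := key 0 (by norm_num)
  obtain ⟨p1, k1⟩ := key 1 (by norm_num)
  have hne : L (r + ε * 1) - L (r + ε * 0) ≠ 0 := fun h0 => by
    have := hL p1 p0 (sub_eq_zero.1 h0)
    linarith
  have hC : C = 0 := by
    refine (mul_eq_zero.1 (?_ : C * _ = 0)).resolve_right hne
    linear_combination k1 - k0
  exact ⟨by linear_combination k0 - L (r + ε * 0) * hC, hC⟩

theorem coeff_Ξ_eq_zero (hUn : U.Nonempty) (hUr : ∀ x ∈ U, 0 < x.2.1) {κ : ℝ}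
    (h : ∀ x ∈ U, κ * x.2.1 = 0) : κ = 0 := by
  obtain ⟨x, hx⟩ := hUn
  exact (mul_eq_zero.1 (h x hx)).resolve_right (hUr x hx).ne'

/-- Reformulation of `HasBasis` in terms of linear combinations of fields on the whole space. -/
theorem hasBasis_pointSymmetries {g f : ℝ → ℝ → ℝ → ℝ} {V : Set ℝ} {d : ℕ} (X : Fin d → Field)
    (hind : ∀ k : Fin d → ℝ, (∀ x ∈ U, ∑ i, k i • X i x = 0) → ∀ i, k i = 0)
    (hspan : ∀ Y, IsPointSymmetry g f U V Y → ∃ k : Fin d → ℝ, ∀ x ∈ U, Y x = ∑ i, k i • X i x)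
    (hsymm : ∀ k : Fin d → ℝ, IsPointSymmetry g f U V (fun x => ∑ i, k i • X i x)) :
    HasBasis U (pointSymmetries g f U V) X := by
  constructor
  · rw [Fintype.linearIndependent_iff]
    intro k hk
    refine hind k fun x hx => ?_
    simpa using congrFun hk ⟨x, hx⟩
  · ext Y
    simp only [SetLike.mem_coe, Submodule.mem_span_range_iff_exists_fun]
    constructor
    · rintro ⟨Z, hZ, rfl⟩
      obtain ⟨k, hk⟩ := hspan Z hZ
      refine ⟨k, funext fun x => ?_⟩
      simpa using (hk x x.2).symm
    · rintro ⟨k, rfl⟩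
      refine ⟨_, hsymm k, funext fun x => ?_⟩
      simp

end Independence

section Bases

variable {n a b c p : ℝ} {U : Set (ℝ × ℝ × ℝ)} {V : Set ℝ}

/-- Shape of the `t`- and `u`-dependence of an arbitrary point symmetry. -/
theorem IsPointSymmetry.exists_form (hn : n ≠ 1) (hb : b ≠ 0) (hab : a + b ≠ 0)
    (hp : p ≠ 0) (hp1 : p ≠ -1) (hU : IsOpen U) (hUc : IsConnected U) (hUr : ∀ x ∈ U, 0 < x.2.1)
    (hV : IsOpen V) (hVn : V.Nonempty) (hVp : V ⊆ powDomain p) {Y : Field}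
    (hY : IsPointSymmetry (gB a b c p) (fB n b c p) U V Y) :
    ContDiffOn ℝ (⊤ : ℕ∞) (fun x => (Y x).2.1) U ∧
    IsDetSolution n a b c p U (fun x => (Y x).1) (fun x => (Y x).2.1) (fun x => (Y x).2.2) ∧
    ∃ α β θ γ δ e : ℝ, (p + 4) * θ = 0 ∧ c * θ = 0 ∧ ∀ x ∈ U,
      (Y x).1 = β + α * x.1 + θ * x.1 ^ 2 ∧ (Y x).2.2 = (e + θ * x.1) * x.2.2 + γ * x.1 + δ ∧
      p * (e + θ * x.1 - dR (fun x => (Y x).2.1) x)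
        = 2 * (dR (fun x => (Y x).2.1) x - (α + 2 * θ * x.1)) ∧
      c * (dR (fun x => (Y x).2.1) x - (α + 2 * θ * x.1)) = 0 := by
  obtain ⟨⟨hT, hΞ, hH⟩, h⟩ := (isPointSymmetry_iff_isDetSolution (T := fun x => (Y x).1)
    (Ξ := fun x => (Y x).2.1) (H := fun x => (Y x).2.2) hn hb hab hp hp1 hU hUr hV hVn hVp).1 hY
  obtain ⟨α, β, θ, γ, δ, e, hf⟩ := h.exists_T_H hU hUc hT hH
  obtain ⟨x₀, hx₀⟩ := hUc.nonempty
  obtain ⟨-, -, -, -, hθ⟩ := hf x₀ hx₀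
  obtain ⟨h4, h5⟩ := h.T_tt hU hT hΞ hH hx₀
  rw [hθ] at h4 h5
  refine ⟨hΞ, h, α, β, θ, γ, δ, e, by linear_combination h4 / 2, by linear_combination h5 / 2,
    fun x hx => ?_⟩
  obtain ⟨f1, f2, f3, f4, -⟩ := hf x hx
  refine ⟨f1, f2, ?_, ?_⟩
  · rw [← f3, ← f4]; exact h.H_u x hx
  · rw [← f3]; exact h.c_eq x hx

theorem IsPointSymmetry.exists_Ξ_linear (hn : n ≠ 1) (hb : b ≠ 0) (hab : a + b ≠ 0)
    (hp : p ≠ 0) (hp1 : p ≠ -1) (hU : IsOpen U) (hUc : IsConnected U) (hUr : ∀ x ∈ U, 0 < x.2.1)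
    (hV : IsOpen V) (hVn : V.Nonempty) (hVp : V ⊆ powDomain p) {Y : Field}
    (hY : IsPointSymmetry (gB a b c p) (fB n b c p) U V Y) (hpc : p ≠ -2 ∨ c ≠ 0) :
    ∃ κ : ℝ, ∀ x ∈ U, (Y x).2.1 = κ * x.2.1 ∧ dR (fun x => (Y x).2.1) x = κ := by
  obtain ⟨⟨hT, hΞ, hH⟩, h⟩ := (isPointSymmetry_iff_isDetSolution (T := fun x => (Y x).1)
    (Ξ := fun x => (Y x).2.1) (H := fun x => (Y x).2.2) hn hb hab hp hp1 hU hUr hV hVn hVp).1 hY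
  refine h.exists_Ξ_linear hn hb hU hUc hΞ fun x hx => ?_
  obtain ⟨h1, h2⟩ := h.Ξ_rr_eq_zero hU hT hΞ hH hx
  rcases hpc with h0 | h0
  · exact (mul_eq_zero.1 h1).resolve_left fun h => h0 (by linarith)
  · exact (mul_eq_zero.1 h2).resolve_left h0

/-- Sufficient conditions for an explicit vector field to be a point symmetry. -/
theorem isPointSymmetry_of_explicit (hn : n ≠ 1) (hb : b ≠ 0) (hab : a + b ≠ 0)
    (hp : p ≠ 0) (hp1 : p ≠ -1) (hU : IsOpen U) (hUr : ∀ x ∈ U, 0 < x.2.1) (hV : IsOpen V)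
    (hVn : V.Nonempty) (hVp : V ⊆ powDomain p) (α β θ γ δ e : ℝ) {ξ ξ' ξ'' : ℝ → ℝ}
    (hs : ContDiffOn ℝ (⊤ : ℕ∞) ξ (Set.Ioi 0))
    (h0 : ∀ r, 0 < r → HasDerivAt ξ (ξ' r) r) (h1 : ∀ r, 0 < r → HasDerivAt ξ' (ξ'' r) r)
    (hu : ∀ x ∈ U, p * (e + θ * x.1 - ξ' x.2.1) = 2 * (ξ' x.2.1 - (α + 2 * θ * x.1)))
    (hc : ∀ x ∈ U, c * (ξ' x.2.1 - (α + 2 * θ * x.1)) = 0)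
    (hr : ∀ r, 0 < r → (a + b) * r ^ 2 * ξ'' r = b * (n - 1) * (r * ξ' r - ξ r)) :
    IsPointSymmetry (gB a b c p) (fB n b c p) U V (fun x => (β + α * x.1 + θ * x.1 ^ 2, ξ x.2.1,
      (e + θ * x.1) * x.2.2 + γ * x.1 + δ)) := by
  refine (isPointSymmetry_iff_isDetSolution hn hb hab hp hp1 hU hUr hV hVn hVp).2
    ⟨⟨by fun_prop, ?_, by fun_prop⟩, isDetSolution_of_explicit hU hUr α β θ γ δ e h0 h1 hu hc hr⟩
  exact hs.comp (g := ξ) (f := fun x : ℝ × ℝ × ℝ => x.2.1) (by fun_prop) fun x hx => hUr x hx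

theorem hasBasis_of_ne_zero (hn : n ≠ 1) (hb : b ≠ 0) (hab : a + b ≠ 0)
    (hp : p ≠ 0) (hp1 : p ≠ -1) (hU : IsOpen U) (hUc : IsConnected U) (hUr : ∀ x ∈ U, 0 < x.2.1)
    (hV : IsOpen V) (hVn : V.Nonempty) (hVp : V ⊆ powDomain p) (hc : c ≠ 0) :
    HasBasis U (pointSymmetries (gB a b c p) (fB n b c p) U V) ![X1, X2, X3, X4] := by
  have hsum : ∀ (k : Fin 4 → ℝ) (x : ℝ × ℝ × ℝ),
      ∑ i, k i • (![X1, X2, X3, X4] : Fin 4 → Field) i x =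
        (k 0 + k 1 * x.1 + 0 * x.1 ^ 2, k 1 * x.2.1,
          (k 1 + 0 * x.1) * x.2.2 + k 3 * x.1 + k 2) := by
    rintro k ⟨t, r, u⟩
    simp [Fin.sum_univ_succ, X1, X2, X3, X4]
    ring
  refine hasBasis_pointSymmetries _ (fun k hk => ?_) (fun Y hY => ?_) (fun k => ?_)
  · simp only [hsum, Prod.mk_eq_zero] at hk
    obtain ⟨k0, k1, -⟩ := coeffs_T_eq_zero hU hUc.nonempty fun x hx => (hk x hx).1
    obtain ⟨-, -, k3, k2⟩ := coeffs_H_eq_zero hU hUc.nonempty fun x hx => (hk x hx).2.2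
    intro i
    fin_cases i <;> assumption
  · obtain ⟨-, -, α, β, θ, γ, δ, e, -, hθ, hf⟩ :=
      hY.exists_form hn hb hab hp hp1 hU hUc hUr hV hVn hVp
    obtain ⟨κ, hκ⟩ := hY.exists_Ξ_linear hn hb hab hp hp1 hU hUc hUr hV hVn hVp (Or.inr hc)
    have hθ : θ = 0 := (mul_eq_zero.1 hθ).resolve_left hc
    obtain ⟨x₀, hx₀⟩ := hUc.nonempty
    obtain ⟨-, -, f3, f4⟩ := hf x₀ hx₀
    rw [(hκ x₀ hx₀).2, hθ] at f3 f4
    have hα : κ = α := by linear_combination (mul_eq_zero.1 f4).resolve_left hc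
    have he : e = α := by
      refine sub_eq_zero.1 ((mul_eq_zero.1 (?_ : p * _ = 0)).resolve_left hp)
      linear_combination f3 + (2 + p) * hα
    refine ⟨![β, α, δ, γ], fun x hx => ?_⟩
    rw [hsum]
    refine Prod.ext ?_ (Prod.ext ?_ ?_)
    · simp [(hf x hx).1, hθ]
    · simp [(hκ x hx).1, hα]
    · simp [(hf x hx).2.1, hθ, he]
  · simp only [hsum]
    refine isPointSymmetry_of_explicit hn hb hab hp hp1 hU hUr hV hVn hVp (k 1) (k 0) 0 (k 3) (k 2)
      (k 1) (ξ := fun r => k 1 * r) (ξ' := fun _ => k 1) (ξ'' := fun _ => 0) (by fun_prop)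
      (fun r _ => by simpa using (hasDerivAt_id r).const_mul (k 1))
      (fun r _ => hasDerivAt_const _ _) ?_ ?_ ?_ <;> intros <;> ring

theorem hasBasis_of_eq_zero (hn : n ≠ 1) (hb : b ≠ 0) (hab : a + b ≠ 0)
    (hp : p ≠ 0) (hp1 : p ≠ -1) (hU : IsOpen U) (hUc : IsConnected U) (hUr : ∀ x ∈ U, 0 < x.2.1)
    (hV : IsOpen V) (hVn : V.Nonempty) (hVp : V ⊆ powDomain p) (hc : c = 0) (hp2 : p ≠ -2)
    (hp4 : p ≠ -4) :
    HasBasis U (pointSymmetries (gB a b c p) (fB n b c p) U V) ![X1, X2, X3, X4, X5 p] := by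
  have hsum : ∀ (k : Fin 5 → ℝ) (x : ℝ × ℝ × ℝ),
      ∑ i, k i • (![X1, X2, X3, X4, X5 p] : Fin 5 → Field) i x =
        (k 0 + (k 1 + p * k 4) * x.1 + 0 * x.1 ^ 2, k 1 * x.2.1,
          ((k 1 - 2 * k 4) + 0 * x.1) * x.2.2 + k 3 * x.1 + k 2) := by
    rintro k ⟨t, r, u⟩
    simp [Fin.sum_univ_succ, X1, X2, X3, X4, X5]
    constructor <;> ring
  refine hasBasis_pointSymmetries _ (fun k hk => ?_) (fun Y hY => ?_) (fun k => ?_)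
  · simp only [hsum, Prod.mk_eq_zero] at hk
    obtain ⟨k0, -, -⟩ := coeffs_T_eq_zero hU hUc.nonempty fun x hx => (hk x hx).1
    have k1 := coeff_Ξ_eq_zero hUc.nonempty hUr fun x hx => (hk x hx).2.1
    obtain ⟨k4, -, k3, k2⟩ := coeffs_H_eq_zero hU hUc.nonempty fun x hx => (hk x hx).2.2
    have k4 : k 4 = 0 := by linear_combination (k1 - k4) / 2
    intro i
    fin_cases i <;> assumption
  · obtain ⟨-, -, α, β, θ, γ, δ, e, hθ, -, hf⟩ :=
      hY.exists_form hn hb hab hp hp1 hU hUc hUr hV hVn hVp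
    obtain ⟨κ, hκ⟩ := hY.exists_Ξ_linear hn hb hab hp hp1 hU hUc hUr hV hVn hVp (Or.inl hp2)
    have hθ : θ = 0 := (mul_eq_zero.1 hθ).resolve_left fun h => hp4 (by linarith)
    obtain ⟨x₀, hx₀⟩ := hUc.nonempty
    obtain ⟨-, -, f3, -⟩ := hf x₀ hx₀
    rw [(hκ x₀ hx₀).2, hθ] at f3
    have he : e = κ - 2 * ((α - κ) / p) := by
      field_simp
      linear_combination f3
    refine ⟨![β, κ, δ, γ, (α - κ) / p], fun x hx => ?_⟩
    rw [hsum]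
    refine Prod.ext ?_ (Prod.ext ?_ ?_)
    · simp [(hf x hx).1, hθ, mul_div_cancel₀, hp]
    · simp [(hκ x hx).1]
    · simp [(hf x hx).2.1, hθ, he]
  · simp only [hsum]
    refine isPointSymmetry_of_explicit hn hb hab hp hp1 hU hUr hV hVn hVp (k 1 + p * k 4) (k 0) 0
      (k 3) (k 2) (k 1 - 2 * k 4) (ξ := fun r => k 1 * r) (ξ' := fun _ => k 1) (ξ'' := fun _ => 0)
      (by fun_prop) (fun r _ => by simpa using (hasDerivAt_id r).const_mul (k 1))
      (fun r _ => hasDerivAt_const _ _) ?_ ?_ ?_ <;> intros <;> subst hc <;> ring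

theorem hasBasis_of_eq_neg_four (hn : n ≠ 1) (hb : b ≠ 0) (hab : a + b ≠ 0)
    (hU : IsOpen U) (hUc : IsConnected U) (hUr : ∀ x ∈ U, 0 < x.2.1)
    (hV : IsOpen V) (hVn : V.Nonempty) (hVp : V ⊆ powDomain p) (hc : c = 0) (hp4 : p = -4) :
    HasBasis U (pointSymmetries (gB a b c p) (fB n b c p) U V) ![X1, X2, X3, X4, X5 p, X6] := by
  have hp : p ≠ 0 := by rw [hp4]; norm_num
  have hp1 : p ≠ -1 := by rw [hp4]; norm_num
  have hp2 : p ≠ -2 := by rw [hp4]; norm_num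
  have hsum : ∀ (k : Fin 6 → ℝ) (x : ℝ × ℝ × ℝ),
      ∑ i, k i • (![X1, X2, X3, X4, X5 p, X6] : Fin 6 → Field) i x =
        (k 0 + (k 1 + p * k 4) * x.1 + k 5 * x.1 ^ 2, k 1 * x.2.1,
          ((k 1 - 2 * k 4) + k 5 * x.1) * x.2.2 + k 3 * x.1 + k 2) := by
    rintro k ⟨t, r, u⟩
    simp [Fin.sum_univ_succ, X1, X2, X3, X4, X5, X6]
    constructor <;> ring
  refine hasBasis_pointSymmetries _ (fun k hk => ?_) (fun Y hY => ?_) (fun k => ?_)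
  · simp only [hsum, Prod.mk_eq_zero] at hk
    obtain ⟨k0, -, k5⟩ := coeffs_T_eq_zero hU hUc.nonempty fun x hx => (hk x hx).1
    have k1 := coeff_Ξ_eq_zero hUc.nonempty hUr fun x hx => (hk x hx).2.1
    obtain ⟨k4, -, k3, k2⟩ := coeffs_H_eq_zero hU hUc.nonempty fun x hx => (hk x hx).2.2
    have k4 : k 4 = 0 := by linear_combination (k1 - k4) / 2
    intro i
    fin_cases i <;> assumption
  · obtain ⟨-, -, α, β, θ, γ, δ, e, -, -, hf⟩ :=
      hY.exists_form hn hb hab hp hp1 hU hUc hUr hV hVn hVp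
    obtain ⟨κ, hκ⟩ := hY.exists_Ξ_linear hn hb hab hp hp1 hU hUc hUr hV hVn hVp (Or.inl hp2)
    obtain ⟨x₀, hx₀⟩ := hUc.nonempty
    obtain ⟨-, -, f3, -⟩ := hf x₀ hx₀
    rw [(hκ x₀ hx₀).2, hp4] at f3
    have he : e = κ - 2 * ((α - κ) / p) := by
      rw [hp4]
      linear_combination -f3 / 4
    refine ⟨![β, κ, δ, γ, (α - κ) / p, θ], fun x hx => ?_⟩
    rw [hsum]
    refine Prod.ext ?_ (Prod.ext ?_ ?_)
    · simp [(hf x hx).1, mul_div_cancel₀, hp]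
    · simp [(hκ x hx).1]
    · simp [(hf x hx).2.1, he]
  · simp only [hsum]
    refine isPointSymmetry_of_explicit hn hb hab hp hp1 hU hUr hV hVn hVp (k 1 + p * k 4) (k 0)
      (k 5) (k 3) (k 2) (k 1 - 2 * k 4) (ξ := fun r => k 1 * r) (ξ' := fun _ => k 1)
      (ξ'' := fun _ => 0) (by fun_prop)
      (fun r _ => by simpa using (hasDerivAt_id r).const_mul (k 1))
      (fun r _ => hasDerivAt_const _ _) ?_ ?_ ?_ <;> intros <;> subst hc hp4 <;> ring

/-- For `p = -2` and `c = 0` the radial component is an arbitrary solution of an Euler equation, one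
solution being `r`; here `χ = μ r L` is a second one. -/
theorem hasBasis_of_eq_neg_two (hn : n ≠ 1) (hb : b ≠ 0) (hab : a + b ≠ 0)
    (hU : IsOpen U) (hUc : IsConnected U) (hUr : ∀ x ∈ U, 0 < x.2.1)
    (hV : IsOpen V) (hVn : V.Nonempty) (hVp : V ⊆ powDomain p) (hc : c = 0) (hp2 : p = -2)
    {m μ : ℝ} (hm : m = -(b * (n - 1)) / (a + b)) {L χ χ' χ'' : ℝ → ℝ} (hμ : μ ≠ 0)
    (hL : ∀ r, 0 < r → HasDerivAt L (r ^ (-m - 2)) r) (hLi : Set.InjOn L (Set.Ioi 0))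
    (hχ : ∀ r, 0 < r → χ r = μ * (r * L r)) (hχs : ContDiffOn ℝ (⊤ : ℕ∞) χ (Set.Ioi 0))
    (hχ1 : ∀ r, 0 < r → HasDerivAt χ (χ' r) r) (hχ2 : ∀ r, 0 < r → HasDerivAt χ' (χ'' r) r)
    (heul : ∀ r, 0 < r → r ^ 2 * χ'' r = -m * (r * χ' r - χ r)) :
    HasBasis U (pointSymmetries (gB a b c p) (fB n b c p) U V)
      ![X1, X2, X3, X4, X5 p, fun x => (0, χ x.2.1, 0)] := by
  have hp : p ≠ 0 := by rw [hp2]; norm_num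
  have hp1 : p ≠ -1 := by rw [hp2]; norm_num
  have hsum : ∀ (k : Fin 6 → ℝ) (x : ℝ × ℝ × ℝ),
      ∑ i, k i • (![X1, X2, X3, X4, X5 p, fun x => (0, χ x.2.1, 0)] : Fin 6 → Field) i x =
        (k 0 + (k 1 + p * k 4) * x.1 + 0 * x.1 ^ 2, k 1 * x.2.1 + k 5 * χ x.2.1,
          ((k 1 - 2 * k 4) + 0 * x.1) * x.2.2 + k 3 * x.1 + k 2) := by
    rintro k ⟨t, r, u⟩
    simp [Fin.sum_univ_succ, X1, X2, X3, X4, X5]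
    constructor <;> ring
  refine hasBasis_pointSymmetries _ (fun k hk => ?_) (fun Y hY => ?_) (fun k => ?_)
  · simp only [hsum, Prod.mk_eq_zero] at hk
    obtain ⟨k0, -, -⟩ := coeffs_T_eq_zero hU hUc.nonempty fun x hx => (hk x hx).1
    obtain ⟨k1, k5⟩ := coeffs_Ξ_eq_zero hU hUc.nonempty hUr hLi (κ := k 1) (C := k 5 * μ)
      fun x hx => by
        have := (hk x hx).2.1
        rw [hχ _ (hUr x hx)] at this
        linear_combination this
    have k5 : k 5 = 0 := (mul_eq_zero.1 k5).resolve_right hμ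
    obtain ⟨k4, -, k3, k2⟩ := coeffs_H_eq_zero hU hUc.nonempty fun x hx => (hk x hx).2.2
    have k4 : k 4 = 0 := by linear_combination (k1 - k4) / 2
    intro i
    fin_cases i <;> assumption
  · obtain ⟨hΞ, hdet, α, β, θ, γ, δ, e, hθ, -, hf⟩ :=
      hY.exists_form hn hb hab hp hp1 hU hUc hUr hV hVn hVp
    obtain ⟨C, D, hCD⟩ := hdet.exists_Ξ_euler hU hUc hUr hab hΞ hm hL
    have hθ : θ = 0 := (mul_eq_zero.1 hθ).resolve_left (by rw [hp2]; norm_num)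
    obtain ⟨x₀, hx₀⟩ := hUc.nonempty
    obtain ⟨-, -, f3, -⟩ := hf x₀ hx₀
    rw [hp2, hθ] at f3
    have he : e = D - 2 * ((α - D) / p) := by
      rw [hp2]
      linear_combination -f3 / 2
    refine ⟨![β, D, δ, γ, (α - D) / p, C / μ], fun x hx => ?_⟩
    rw [hsum]
    refine Prod.ext ?_ (Prod.ext ?_ ?_)
    · simp [(hf x hx).1, hθ, mul_div_cancel₀, hp]
    · simp [hCD x hx, hχ _ (hUr x hx)]
      field_simp
    · simp [(hf x hx).2.1, hθ, he]
  · simp only [hsum]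
    refine isPointSymmetry_of_explicit hn hb hab hp hp1 hU hUr hV hVn hVp (k 1 + p * k 4) (k 0) 0
      (k 3) (k 2) (k 1 - 2 * k 4) (ξ := fun r => k 1 * r + k 5 * χ r)
      (ξ' := fun r => k 1 + k 5 * χ' r) (ξ'' := fun r => k 5 * χ'' r)
      ((by fun_prop : ContDiffOn ℝ (⊤ : ℕ∞) (fun r => k 1 * r) (Set.Ioi 0)).add
        (contDiffOn_const.mul hχs))
      (fun r hr => (((hasDerivAt_id r).const_mul (k 1)).add
        ((hχ1 r hr).const_mul (k 5))).congr_deriv (by rw [mul_one]))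
      (fun r hr => ((hχ2 r hr).const_mul (k 5)).const_add (k 1)) ?_ ?_ ?_
    · intros; simp only [hp2]; ring
    · intros; simp only [hc]; ring
    · intro r hr
      have e1 := heul r hr
      rw [hm] at e1
      field_simp at e1
      linear_combination k 5 * e1

/-- The second solution `r^{-m}` of the Euler equation is `(-m-1) r L` for the primitive
`L = r^{-m-1} / (-m-1)` of `r^{-m-2}`, provided `m ≠ -1`. -/
theorem hasBasis_X7 (hn : n ≠ 1) (hb : b ≠ 0) (hab : a + b ≠ 0)
    (hU : IsOpen U) (hUc : IsConnected U) (hUr : ∀ x ∈ U, 0 < x.2.1)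
    (hV : IsOpen V) (hVn : V.Nonempty) (hVp : V ⊆ powDomain p) (hc : c = 0) (hp2 : p = -2)
    {m : ℝ} (hm : m = -(b * (n - 1)) / (a + b)) (hm1 : m + 1 ≠ 0) :
    HasBasis U (pointSymmetries (gB a b c p) (fB n b c p) U V)
      ![X1, X2, X3, X4, X5 p, X7 m] := by
  have hm1' : -m - 1 ≠ 0 := fun h => hm1 (by linear_combination -h)
  have hpow : ∀ q r : ℝ, 0 < r → HasDerivAt (fun r : ℝ => r ^ q) (q * r ^ (q - 1)) r :=
    fun q r hr => Real.hasDerivAt_rpow_const (Or.inl hr.ne')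
  refine hasBasis_of_eq_neg_two hn hb hab hU hUc hUr hV hVn hVp hc hp2 hm (μ := -m - 1)
    (L := fun r => r ^ (-m - 1) / (-m - 1)) (χ := fun r => r ^ (-m))
    (χ' := fun r => -m * r ^ (-m - 1)) (χ'' := fun r => -m * ((-m - 1) * r ^ (-m - 1 - 1))) hm1'
    (fun r hr => ?_) ?_ (fun r hr => ?_) (fun r hr => ?_) (hpow _)
    (fun r hr => (hpow _ r hr).const_mul _) (fun r hr => ?_)
  · refine ((hpow (-m - 1) r hr).div_const (-m - 1)).congr_deriv ?_
    rw [mul_div_cancel_left₀ _ hm1']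
    ring_nf
  · intro r hr s hs h
    exact Real.rpow_left_injOn hm1' (Set.mem_Ioi.1 hr).le (Set.mem_Ioi.1 hs).le
      ((div_left_inj' hm1').1 h)
  · have := hr.ne'
    simp only [Real.rpow_sub_one hr.ne']
    field_simp
  · exact (contDiffAt_id.rpow_const_of_ne (Set.mem_Ioi.1 hr).ne').contDiffWithinAt
  · have := hr.ne'
    simp only [Real.rpow_sub_one hr.ne']
    field_simp

/-- For `a = b (n-2)` the exponent `-m` is `1`, so that `r` is a double solution of the Euler
equation and the second solution is `r ln r`. -/
theorem hasBasis_X8 (hn : n ≠ 1) (hb : b ≠ 0) (hab : a + b ≠ 0)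
    (hU : IsOpen U) (hUc : IsConnected U) (hUr : ∀ x ∈ U, 0 < x.2.1)
    (hV : IsOpen V) (hVn : V.Nonempty) (hVp : V ⊆ powDomain p) (hc : c = 0) (hp2 : p = -2)
    (ha : a = b * (n - 2)) :
    HasBasis U (pointSymmetries (gB a b c p) (fB n b c p) U V)
      ![X1, X2, X3, X4, X5 p, X8] := by
  have hlog : ∀ r : ℝ, 0 < r → HasDerivAt Real.log r⁻¹ r := fun r hr => Real.hasDerivAt_log hr.ne'
  refine hasBasis_of_eq_neg_two hn hb hab hU hUc hUr hV hVn hVp hc hp2 (m := -1) (μ := 1) ?_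
    (L := Real.log) (χ := fun r => r * Real.log r)
    (χ' := fun r => Real.log r + 1) (χ'' := fun r => r⁻¹) one_ne_zero
    (fun r hr => ?_) Real.log_injOn_pos (fun r hr => (one_mul _).symm) (fun r hr => ?_)
    (fun r hr => Real.hasDerivAt_mul_log hr.ne') (fun r hr => (hlog r hr).add_const 1)
    (fun r hr => ?_)
  · field_simp
    linear_combination -ha
  · refine (hlog r hr).congr_deriv ?_
    norm_num [Real.rpow_neg_one]
  · exact (contDiffAt_id.mul (Real.contDiffAt_log.2 (Set.mem_Ioi.1 hr).ne')).contDiffWithinAt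
  · have := hr.ne'
    field_simp
    ring

end Bases

/-! ### Commutators -/

section Commutators

variable {p m : ℝ} {U : Set (ℝ × ℝ × ℝ)} (x h : ℝ × ℝ × ℝ)

theorem fderiv_components {f₁ f₂ f₃ : ℝ × ℝ × ℝ → ℝ} {f₁' f₂' f₃' : ℝ × ℝ × ℝ →L[ℝ] ℝ}
    (h₁ : HasFDerivAt f₁ f₁' x) (h₂ : HasFDerivAt f₂ f₂' x) (h₃ : HasFDerivAt f₃ f₃' x) :
    fderiv ℝ (fun x => (f₁ x, f₂ x, f₃ x)) x h = (f₁' h, f₂' h, f₃' h) := by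
  rw [(h₁.prodMk (h₂.prodMk h₃)).fderiv]; rfl

theorem hasFDerivAt_coord_t : HasFDerivAt (fun x : ℝ × ℝ × ℝ => x.1)
    (ContinuousLinearMap.fst ℝ ℝ (ℝ × ℝ)) x := hasFDerivAt_fst

theorem hasFDerivAt_coord_r : HasFDerivAt (fun x : ℝ × ℝ × ℝ => x.2.1)
    ((ContinuousLinearMap.fst ℝ ℝ ℝ).comp (ContinuousLinearMap.snd ℝ ℝ (ℝ × ℝ))) x :=
  hasFDerivAt_snd.fst

theorem hasFDerivAt_coord_u : HasFDerivAt (fun x : ℝ × ℝ × ℝ => x.2.2)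
    ((ContinuousLinearMap.snd ℝ ℝ ℝ).comp (ContinuousLinearMap.snd ℝ ℝ (ℝ × ℝ))) x :=
  hasFDerivAt_snd.snd

theorem fderiv_X1 : fderiv ℝ X1 x h = 0 := by
  unfold X1; simp

theorem fderiv_X2 : fderiv ℝ X2 x h = h := by
  have : HasFDerivAt X2 (ContinuousLinearMap.id ℝ _) x := hasFDerivAt_id x
  rw [this.fderiv]; rfl

theorem fderiv_X3 : fderiv ℝ X3 x h = 0 := by
  unfold X3; simp

theorem fderiv_X4 : fderiv ℝ X4 x h = (0, 0, h.1) :=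
  fderiv_components x h (hasFDerivAt_const (0 : ℝ) x) (hasFDerivAt_const (0 : ℝ) x)
    (hasFDerivAt_coord_t x)

theorem fderiv_X5 : fderiv ℝ (X5 p) x h = (p * h.1, 0, -2 * h.2.2) :=
  fderiv_components x h ((hasFDerivAt_coord_t x).const_mul p) (hasFDerivAt_const (0 : ℝ) x)
    ((hasFDerivAt_coord_u x).const_mul (-2))

theorem fderiv_X6 : fderiv ℝ X6 x h = (2 * x.1 * h.1, 0, x.1 * h.2.2 + h.1 * x.2.2) := by
  refine (fderiv_components x h ((hasFDerivAt_coord_t x).pow 2) (hasFDerivAt_const (0 : ℝ) x)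
    ((hasFDerivAt_coord_t x).mul (hasFDerivAt_coord_u x))).trans ?_
  simp [mul_comm]

theorem fderiv_X7 (hx : 0 < x.2.1) :
    fderiv ℝ (X7 m) x h = (0, -m * x.2.1 ^ (-m - 1) * h.2.1, 0) :=
  fderiv_components (f₂ := (fun r => r ^ (-m)) ∘ fun x => x.2.1) x h (hasFDerivAt_const (0 : ℝ) x)
    ((Real.hasDerivAt_rpow_const (p := -m) (Or.inl hx.ne')).comp_hasFDerivAt x
      (hasFDerivAt_coord_r x)) (hasFDerivAt_const (0 : ℝ) x)

theorem fderiv_X8 (hx : 0 < x.2.1) :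
    fderiv ℝ X8 x h = (0, (Real.log x.2.1 + 1) * h.2.1, 0) :=
  fderiv_components (f₂ := (fun r => r * Real.log r) ∘ fun x => x.2.1) x h (hasFDerivAt_const (0 : ℝ) x)
    ((Real.hasDerivAt_mul_log hx.ne').comp_hasFDerivAt x (hasFDerivAt_coord_r x))
    (hasFDerivAt_const (0 : ℝ) x)

theorem comm_of_fderiv (hUr : ∀ x ∈ U, 0 < x.2.1) {X Y Z : Field}
    (h : ∀ x, 0 < x.2.1 → fderiv ℝ Y x (X x) - fderiv ℝ X x (Y x) = Z x) : Comm U X Y Z :=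
  fun x hx => h x (hUr x hx)

theorem comm_X1_to_X4 (hUr : ∀ x ∈ U, 0 < x.2.1) :
    Comm U X1 X2 X1 ∧ Comm U X1 X3 0 ∧ Comm U X1 X4 X3 ∧ Comm U X2 X3 (-X3) ∧
    Comm U X2 X4 0 ∧ Comm U X3 X4 0 := by
  refine ⟨?_, ?_, ?_, ?_, ?_, ?_⟩ <;> refine comm_of_fderiv hUr fun x _ => ?_ <;>
    simp only [fderiv_X1, fderiv_X2, fderiv_X3, fderiv_X4] <;>
    ext <;> simp [X1, X2, X3, X4]

theorem comm_X5 (hUr : ∀ x ∈ U, 0 < x.2.1) :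
    Comm U X1 (X5 p) (p • X1) ∧ Comm U X2 (X5 p) 0 ∧
    Comm U X3 (X5 p) ((-2 : ℝ) • X3) ∧ Comm U X4 (X5 p) (-(2 + p) • X4) := by
  refine ⟨?_, ?_, ?_, ?_⟩ <;> refine comm_of_fderiv hUr fun x _ => ?_ <;>
    simp only [fderiv_X1, fderiv_X2, fderiv_X3, fderiv_X4, fderiv_X5] <;>
    ext <;> simp [X1, X2, X3, X4, X5]
  ring

theorem comm_X6 (hUr : ∀ x ∈ U, 0 < x.2.1) (hp : p = -4) :
    Comm U X1 X6 ((-(1 / 2) : ℝ) • X5 p) ∧ Comm U X2 X6 X6 ∧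
    Comm U X3 X6 X4 ∧ Comm U X4 X6 0 ∧ Comm U (X5 p) X6 ((-4 : ℝ) • X6) := by
  subst hp
  refine ⟨?_, ?_, ?_, ?_, ?_⟩ <;> refine comm_of_fderiv hUr fun x _ => ?_ <;>
    simp only [fderiv_X1, fderiv_X2, fderiv_X3, fderiv_X4, fderiv_X5, fderiv_X6] <;>
    ext <;> simp [X1, X2, X3, X4, X5, X6] <;> ring

theorem comm_X7 (hUr : ∀ x ∈ U, 0 < x.2.1) :
    Comm U X1 (X7 m) 0 ∧ Comm U X2 (X7 m) (-(m + 1) • X7 m) ∧ Comm U X3 (X7 m) 0 ∧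
    Comm U X4 (X7 m) 0 ∧ Comm U (X5 p) (X7 m) 0 := by
  refine ⟨?_, ?_, ?_, ?_, ?_⟩ <;> refine comm_of_fderiv hUr fun x hx => ?_ <;>
    simp only [fderiv_X1, fderiv_X2, fderiv_X3, fderiv_X4, fderiv_X5, fderiv_X7 _ _ hx] <;>
    ext <;> simp [X1, X2, X3, X4, X5, X7]
  rw [Real.rpow_sub_one hx.ne']
  field_simp
  ring

theorem comm_X8 (hUr : ∀ x ∈ U, 0 < x.2.1) (hp : p = -2) :
    Comm U X1 X8 0 ∧ Comm U X2 X8 (X2 + (1 / 2 : ℝ) • X5 p) ∧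
    Comm U X3 X8 0 ∧ Comm U X4 X8 0 ∧ Comm U (X5 p) X8 0 := by
  subst hp
  refine ⟨?_, ?_, ?_, ?_, ?_⟩ <;> refine comm_of_fderiv hUr fun x hx => ?_ <;>
    simp only [fderiv_X1, fderiv_X2, fderiv_X3, fderiv_X4, fderiv_X5, fderiv_X8 _ _ hx] <;>
    ext <;> simp [X1, X2, X3, X4, X5, X8]
  ring

end Commutators

end RadialWave

theorem theorem3 (n a b c p : ℝ) (hn : n ≠ 1) (hb : b ≠ 0) (hab : a + b ≠ 0)
    (hp : p ≠ 0) (hp1 : p ≠ -1)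
    (U : Set (ℝ × ℝ × ℝ)) (hU : IsOpen U) (hUc : IsConnected U) (hUr : ∀ x ∈ U, 0 < x.2.1)
    (V : Set ℝ) (hV : IsOpen V) (hVn : V.Nonempty) (hVp : V ⊆ RadialWave.powDomain p) :
    -- the general case
    (c ≠ 0 →
      RadialWave.HasBasis U
        (RadialWave.pointSymmetries (RadialWave.gB a b c p) (RadialWave.fB n b c p) U V)
        ![RadialWave.X1, RadialWave.X2, RadialWave.X3, RadialWave.X4]) ∧
    (RadialWave.Comm U RadialWave.X1 RadialWave.X2 RadialWave.X1 ∧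
      RadialWave.Comm U RadialWave.X1 RadialWave.X3 0 ∧
      RadialWave.Comm U RadialWave.X1 RadialWave.X4 RadialWave.X3 ∧
      RadialWave.Comm U RadialWave.X2 RadialWave.X3 (-RadialWave.X3) ∧
      RadialWave.Comm U RadialWave.X2 RadialWave.X4 0 ∧
      RadialWave.Comm U RadialWave.X3 RadialWave.X4 0) ∧
    -- the case `c = 0`
    (c = 0 →
      (RadialWave.Comm U RadialWave.X1 (RadialWave.X5 p) (p • RadialWave.X1) ∧
        RadialWave.Comm U RadialWave.X2 (RadialWave.X5 p) 0 ∧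
        RadialWave.Comm U RadialWave.X3 (RadialWave.X5 p) ((-2 : ℝ) • RadialWave.X3) ∧
        RadialWave.Comm U RadialWave.X4 (RadialWave.X5 p) (-(2 + p) • RadialWave.X4)) ∧
      (p ≠ -2 → p ≠ -4 →
        RadialWave.HasBasis U
          (RadialWave.pointSymmetries (RadialWave.gB a b c p) (RadialWave.fB n b c p) U V)
          ![RadialWave.X1, RadialWave.X2, RadialWave.X3, RadialWave.X4, RadialWave.X5 p]) ∧
      (p = -4 →
        RadialWave.HasBasis U
          (RadialWave.pointSymmetries (RadialWave.gB a b c p) (RadialWave.fB n b c p) U V)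
          ![RadialWave.X1, RadialWave.X2, RadialWave.X3, RadialWave.X4, RadialWave.X5 p,
            RadialWave.X6] ∧
        RadialWave.Comm U RadialWave.X1 RadialWave.X6 ((-(1 / 2) : ℝ) • RadialWave.X5 p) ∧
        RadialWave.Comm U RadialWave.X2 RadialWave.X6 RadialWave.X6 ∧
        RadialWave.Comm U RadialWave.X3 RadialWave.X6 RadialWave.X4 ∧
        RadialWave.Comm U RadialWave.X4 RadialWave.X6 0 ∧
        RadialWave.Comm U (RadialWave.X5 p) RadialWave.X6 ((-4 : ℝ) • RadialWave.X6)) ∧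
      (p = -2 → a ≠ b * (n - 2) →
        ∀ m : ℝ, m = b * (n - 1) * (p + 1) / (a + b) →
        RadialWave.HasBasis U
          (RadialWave.pointSymmetries (RadialWave.gB a b c p) (RadialWave.fB n b c p) U V)
          ![RadialWave.X1, RadialWave.X2, RadialWave.X3, RadialWave.X4, RadialWave.X5 p,
            RadialWave.X7 m] ∧
        RadialWave.Comm U RadialWave.X1 (RadialWave.X7 m) 0 ∧
        RadialWave.Comm U RadialWave.X2 (RadialWave.X7 m) (-(m + 1) • RadialWave.X7 m) ∧
        RadialWave.Comm U RadialWave.X3 (RadialWave.X7 m) 0 ∧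
        RadialWave.Comm U RadialWave.X4 (RadialWave.X7 m) 0 ∧
        RadialWave.Comm U (RadialWave.X5 p) (RadialWave.X7 m) 0) ∧
      (p = -2 → a = b * (n - 2) →
        RadialWave.HasBasis U
          (RadialWave.pointSymmetries (RadialWave.gB a b c p) (RadialWave.fB n b c p) U V)
          ![RadialWave.X1, RadialWave.X2, RadialWave.X3, RadialWave.X4, RadialWave.X5 p,
            RadialWave.X8] ∧
        RadialWave.Comm U RadialWave.X1 RadialWave.X8 0 ∧
        RadialWave.Comm U RadialWave.X2 RadialWave.X8
          (RadialWave.X2 + (1 / 2 : ℝ) • RadialWave.X5 p) ∧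
        RadialWave.Comm U RadialWave.X3 RadialWave.X8 0 ∧
        RadialWave.Comm U RadialWave.X4 RadialWave.X8 0 ∧
        RadialWave.Comm U (RadialWave.X5 p) RadialWave.X8 0)) := by
  refine ⟨RadialWave.hasBasis_of_ne_zero hn hb hab hp hp1 hU hUc hUr hV hVn hVp,
    RadialWave.comm_X1_to_X4 hUr, fun hc => ⟨RadialWave.comm_X5 hUr,
    RadialWave.hasBasis_of_eq_zero hn hb hab hp hp1 hU hUc hUr hV hVn hVp hc,
    fun hp4 => ⟨RadialWave.hasBasis_of_eq_neg_four hn hb hab hU hUc hUr hV hVn hVp hc hp4,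
      RadialWave.comm_X6 hUr hp4⟩,
    fun hp2 ha m hm => ⟨?_, RadialWave.comm_X7 hUr⟩,
    fun hp2 ha => ⟨RadialWave.hasBasis_X8 hn hb hab hU hUc hUr hV hVn hVp hc hp2 ha,
      RadialWave.comm_X8 hUr hp2⟩⟩⟩
  rw [hp2] at hm
  refine RadialWave.hasBasis_X7 hn hb hab hU hUc hUr hV hVn hVp hc hp2
    (by rw [hm]; ring) fun h => ha ?_
  rw [hm] at h
  field_simp at h
  linear_combination h
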